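/- All groups are finite. A subgroup $M$ of a group $G$ is *modular* in $G$ if it is a modular element of the subgroup lattice of $G$, i.e. $\langle X,M\rangle\cap Z=\langle X,M\cap Z\rangle$ for all subgroups $X\le Z$ of $G$, and $\langle M,Y\rangle\cap Z=\langle M,Y\cap Z\rangle$ for all subgroups $Y,Z$ of $G$ with $M\le Z$. A subgroup $H$ of $G$ is *submodular* in $G$ if there is a chain of subgroups $H=H_0\le H_1\le\dots\le H_n=G$ such that $H_i$ is modular in $H_{i+1}$ for every $i<n$. Let $\mathfrak{Z}$ be the class of all groups in which every Sylow subgroup is submodular, $\mathfrak{C}$ the class of all groups in which every cyclic primary subgroup (cyclic subgroup of prime power order) is submodular, and $\mathcal{A}$ the class of all groups with abelian Sylow subgroups. Let $F(G)$ be the Fitting subgroup of $G$ (generated by all nilpotent normal subgroups of $G$), and let $G^{\mathcal{A}}$ be the intersection of all normal subgroups $N$ of $G$ with $G/N\in\mathcal{A}$. **Theorem.** Let $A$ and $B$ be submodular subgroups of a group $G=AB$ and let $A,B\in\mathfrak{C}$. The following statements hold. (1) If $\gcd(|G:AF(G)|,|G:BF(G)|)=1$, then $G\in\mathfrak{C}$.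 (2) If $G^{\mathcal{A}}$ is nilpotent, then $G\in\mathfrak{Z}$. -/

import Mathlib

open scoped Pointwise

/-- `M` is a modular element of the lattice `L`:
(1) `(x ⊔ M) ⊓ z = x ⊔ (M ⊓ z)` for all `x ≤ z`;
(2) `(M ⊔ y) ⊓ z = M ⊔ (y ⊓ z)` for all `y` and all `z ≥ M`. -/
def IsModularElement {L : Type*} [Lattice L] (M : L) : Prop :=
  (∀ x z : L, x ≤ z → (x ⊔ M) ⊓ z = x ⊔ (M ⊓ z)) ∧
    (∀ y z : L, M ≤ z → (M ⊔ y) ⊓ z = M ⊔ (y ⊓ z))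

/-- `H` is a modular subgroup of `G`: a modular element of the subgroup lattice of `G`. -/
def IsModularSubgroup {G : Type*} [Group G] (H : Subgroup G) : Prop :=
  IsModularElement H

/-- `H` is submodular in `G`: there is a chain `H = H₀ ≤ H₁ ≤ ⋯ ≤ Hₙ = G` of subgroups of `G`
such that `Hᵢ` is a modular subgroup of the group `Hᵢ₊₁` for every `i < n`. -/
def IsSubmodular {G : Type*} [Group G] (H : Subgroup G) : Prop :=
  ∃ (n : ℕ) (c : ℕ → Subgroup G), c 0 = H ∧ c n = ⊤ ∧
    ∀ i < n, c i ≤ c (i + 1) ∧ IsModularSubgroup ((c i).subgroupOf (c (i + 1)))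

/-- The class of groups all of whose Sylow subgroups are submodular. -/
def InClassZ (G : Type*) [Group G] : Prop :=
  ∀ (p : ℕ), p.Prime → ∀ P : Sylow p G, IsSubmodular (P : Subgroup G)

/-- The class of groups all of whose cyclic primary subgroups (cyclic subgroups of prime power
order) are submodular. -/
def InClassC (G : Type*) [Group G] : Prop :=
  ∀ (p : ℕ), p.Prime → ∀ X : Subgroup G, IsCyclic X → IsPGroup p X → IsSubmodular X

/-- The class of groups all of whose Sylow subgroups are abelian. -/
def HasAbelianSylows (G : Type*) [Group G] : Prop :=
  ∀ (p : ℕ), p.Prime → ∀ P : Sylow p G, IsMulCommutative (P : Subgroup G)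

/-- The residual of `G` for the class of groups with abelian Sylow subgroups: the intersection of
all normal subgroups `N` of `G` such that `G ⧸ N` has abelian Sylow subgroups. -/
def abelianSylowResidual (G : Type*) [Group G] : Subgroup G :=
  sInf {N : Subgroup G | ∃ _ : N.Normal, HasAbelianSylows (G ⧸ N)}

/-- The Fitting subgroup of a finite group `G`: the subgroup generated by all nilpotent normal
subgroups of `G`. -/
def fittingSubgroup (G : Type*) [Group G] : Subgroup G :=
  sSup {N : Subgroup G | N.Normal ∧ Group.IsNilpotent N}

/-!
The proof goes by induction on `|G|`, factoring out the Sylow subgroup `P` for the largest prime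
divisor `p` of `|G|`, which turns out to be normal. It rests on three facts about modular subgroups.

* *The Sylow subgroup for the largest prime is normal.* A maximal modular subgroup which is not
  normal is a maximal subgroup (`IsMaximalModular.isCoatom`), and then modularity says that it meets
  every subgroup not below it in a maximal subgroup of the latter (`ModularIn.inf_covBy`). From
  this and Burnside's transfer theorem one gets `O_p(M) ≤ O_p(G)` for modular `M`
  (`ModularIn.pCore_le_pCore_top`). So submodular `p`-subgroups lie in `O_p(G)`, in particular the
  `p`-elements of `A` and of `B`, and `O_p(G)` is a Sylow subgroup of `G = A B`
  (`not_dvd_index_pCore`).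
* *Submodularity restricts the action on `P`.* If `⟨x⟩` is a submodular `q`-subgroup, `q ≠ p`, then
  `x ^ q` centralizes `P`, and so does `x` unless `q` divides `p - 1` (`SubmodularIn.actsTamely`).
  The element `x` is then said to act tamely.
* *Conversely*, a subgroup `Q` all of whose elements act tamely on `P`, and which acts on `P`
  through an abelian group, is submodular in `Q P` (`SubmodularIn.of_actsTamely`). The case where
  `Q` centralizes `P` is clear. Otherwise `q` divides `p - 1`, so the elements of `Q` act
  diagonalizably on elementary abelian sections of `P`, and `Q` normalizes a subgroup of order `p`
  of `P`. This reduces the assertion to `|P| = p`, where modulo a kernel the order of `Q P` divides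
  `p q` and all subgroups are modular.

All `p`-subgroups of `G` lie in `P`, so they are subnormal. For a `q`-subgroup `X` with `q ≠ p`, by
induction and by inverse images `X P` is submodular in `G`, and it remains to see that `X` is
submodular in `X P`, which follows if `X` acts on `P` tamely and through an abelian group.

If the indices of `A F(G)` and `B F(G)` are coprime and `X` is a cyclic `q`-group, then `A` or `B`
covers a Sylow `q`-subgroup of `G` modulo `F(G) ≤ P C_G(P)`. So modulo `C_G(P)` the elements of `X`
are conjugate to `q`-elements of `A` or of `B` and act tamely (`actsTamely_of_not_dvd_index`).

If `G^𝒜` is nilpotent and `X` is a Sylow `q`-subgroup, then the derived subgroup of `X` lies in the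
Sylow `q`-subgroup of the nilpotent normal subgroup `G^𝒜` and centralizes `P`, so `X` acts through
an abelian group. Up to conjugation `X` is generated by `X ∩ A` and `X ∩ B`
(`exists_sylow_le_sup`), whose elements act tamely, and so `X` does (`actsTamely_of_commute`).
-/

/-! ### Modular and submodular subgroups of subgroups -/

namespace Subgroup

variable {G G' : Type*} [Group G] [Group G']

/-- `M` is a modular subgroup of the group `K`, both being subgroups of an ambient group `G`.
Only the nontrivial inclusions of the two modular identities are recorded. -/
def ModularIn (M K : Subgroup G) : Prop :=
  M ≤ K ∧ (∀ x z, x ≤ z → z ≤ K → (x ⊔ M) ⊓ z ≤ x ⊔ (M ⊓ z)) ∧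
    (∀ y z, M ≤ z → y ≤ K → z ≤ K → (M ⊔ y) ⊓ z ≤ M ⊔ (y ⊓ z))

/-- `H` is submodular in the group `K`, both being subgroups of an ambient group `G`. -/
def SubmodularIn (H K : Subgroup G) : Prop :=
  Relation.ReflTransGen ModularIn H K

namespace ModularIn

variable {M K L : Subgroup G}

lemma le (h : ModularIn M K) : M ≤ K := h.1

lemma sup_inf (h : ModularIn M K) {x z : Subgroup G} (hxz : x ≤ z) (hz : z ≤ K) :
    (x ⊔ M) ⊓ z = x ⊔ (M ⊓ z) :=
  le_antisymm (h.2.1 x z hxz hz)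
    (sup_le (le_inf le_sup_left hxz) (inf_le_inf_right _ le_sup_right))

lemma sup_inf' (h : ModularIn M K) {y z : Subgroup G} (hMz : M ≤ z) (hy : y ≤ K) (hz : z ≤ K) :
    (M ⊔ y) ⊓ z = M ⊔ (y ⊓ z) :=
  le_antisymm (h.2.2 y z hMz hy hz)
    (sup_le (le_inf le_sup_left hMz) (inf_le_inf_right _ le_sup_right))

lemma mono (h : ModularIn M K) (hML : M ≤ L) (hLK : L ≤ K) : ModularIn M L :=
  ⟨hML, fun x z hxz hz => h.2.1 x z hxz (hz.trans hLK),
    fun y z hz hy hzL => h.2.2 y z hz (hy.trans hLK) (hzL.trans hLK)⟩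

/-- The intersection of a modular subgroup with a subgroup is modular in the latter. -/
lemma inf (h : ModularIn M K) (L : Subgroup G) : ModularIn (M ⊓ L) (K ⊓ L) := by
  refine ⟨inf_le_inf_right _ h.le, fun x z hxz hz => ?_, fun y z hMz hy hz => ?_⟩
  · have hzK := hz.trans inf_le_left
    calc (x ⊔ M ⊓ L) ⊓ z ≤ (x ⊔ M) ⊓ z := inf_le_inf_right _ (sup_le_sup_left inf_le_left _)
      _ = x ⊔ (M ⊓ z) := h.sup_inf hxz hzK
      _ ≤ x ⊔ (M ⊓ L ⊓ z) :=
        sup_le_sup_left (le_inf (le_inf inf_le_left (inf_le_right.trans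
          (hz.trans inf_le_right))) inf_le_right) _
  · have hzK := hz.trans inf_le_left
    have hyK := hy.trans inf_le_left
    have e1 : (M ⊔ y) ⊓ (M ⊔ z) = M ⊔ (y ⊓ (M ⊔ z)) :=
      h.sup_inf' le_sup_left hyK (sup_le h.le hzK)
    have e2 : y ⊓ (M ⊔ z) ≤ z := by
      calc y ⊓ (M ⊔ z) ≤ (z ⊔ M) ⊓ (K ⊓ L) := by
            rw [sup_comm z M]; exact le_inf inf_le_right (inf_le_left.trans hy)
        _ = z ⊔ (M ⊓ (K ⊓ L)) := h.sup_inf hz inf_le_left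
        _ ≤ z := sup_le le_rfl ((le_inf inf_le_left (inf_le_right.trans inf_le_right)).trans hMz)
    have hyz : y ⊓ z ≤ K ⊓ L := inf_le_left.trans hy
    calc (M ⊓ L ⊔ y) ⊓ z ≤ (M ⊔ y) ⊓ (M ⊔ z) ⊓ (K ⊓ L) :=
          le_inf (le_inf (inf_le_left.trans (sup_le_sup_right inf_le_left _))
            (inf_le_right.trans le_sup_right)) (inf_le_right.trans hz)
      _ ≤ (y ⊓ z ⊔ M) ⊓ (K ⊓ L) := by
          rw [e1]
          refine inf_le_inf_right _ (sup_le le_sup_right ?_)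
          exact (le_inf inf_le_left e2).trans le_sup_left
      _ = y ⊓ z ⊔ (M ⊓ (K ⊓ L)) := h.sup_inf hyz inf_le_left
      _ ≤ M ⊓ L ⊔ y ⊓ z := by
          rw [sup_comm]
          exact sup_le_sup_right (le_inf inf_le_left (inf_le_right.trans inf_le_right)) _

/-- The join of two modular subgroups is modular. -/
lemma sup {N : Subgroup G} (h : ModularIn M K) (h' : ModularIn N K) : ModularIn (M ⊔ N) K := by
  refine ⟨sup_le h.le h'.le, fun x z hxz hz => ?_, fun y z hMz hy hz => ?_⟩
  · have hMz : M ⊔ z ≤ K := sup_le h.le hz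
    have hX : x ⊔ z ⊓ (M ⊔ N) ≤ z := sup_le hxz inf_le_left
    have e1 : (M ⊔ (x ⊔ N)) ⊓ (M ⊔ z) = M ⊔ ((x ⊔ N) ⊓ (M ⊔ z)) :=
      h.sup_inf' le_sup_left (sup_le (hxz.trans hz) h'.le) hMz
    have e2 : (x ⊔ N) ⊓ (M ⊔ z) = x ⊔ (N ⊓ (M ⊔ z)) :=
      h'.sup_inf (hxz.trans le_sup_right) hMz
    have e3 : (M ⊔ z) ⊓ (M ⊔ N) = M ⊔ (z ⊓ (M ⊔ N)) :=
      h.sup_inf' le_sup_left hz (sup_le h.le h'.le)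
    calc (x ⊔ (M ⊔ N)) ⊓ z ≤ ((M ⊔ (x ⊔ N)) ⊓ (M ⊔ z)) ⊓ z := by
          rw [sup_left_comm]
          exact le_inf (le_inf inf_le_left (inf_le_right.trans le_sup_right)) inf_le_right
      _ ≤ (x ⊔ z ⊓ (M ⊔ N) ⊔ M) ⊓ z := by
          rw [e1, e2]
          refine inf_le_inf_right _ (sup_le le_sup_right (sup_le
            (le_sup_left.trans le_sup_left) ?_))
          have : N ⊓ (M ⊔ z) ≤ (M ⊔ z) ⊓ (M ⊔ N) :=
            le_inf inf_le_right (inf_le_left.trans le_sup_right)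
          rw [e3] at this
          exact this.trans (sup_le le_sup_right (le_sup_right.trans le_sup_left))
      _ = x ⊔ z ⊓ (M ⊔ N) ⊔ (M ⊓ z) := h.sup_inf hX hz
      _ ≤ x ⊔ (M ⊔ N) ⊓ z :=
          sup_le (by rw [inf_comm]) ((inf_le_inf_right _ le_sup_left).trans le_sup_right)
  · have hM : M ≤ z := le_sup_left.trans hMz
    have hN : N ≤ z := le_sup_right.trans hMz
    rw [sup_assoc, h.sup_inf' hM (sup_le h'.le hy) hz, h'.sup_inf' hN hy hz, sup_assoc]

/-- Images of modular subgroups under homomorphisms are modular in the image. -/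
lemma map (h : ModularIn M K) (f : G →* G') : ModularIn (M.map f) (K.map f) := by
  have key : ∀ w : Subgroup G', w ≤ K.map f → (w.comap f ⊓ K).map f = w := by
    intro w hw
    refine le_antisymm ((map_mono inf_le_left).trans (map_comap_le _ _)) fun y hy => ?_
    obtain ⟨k, hk, rfl⟩ := hw hy
    exact ⟨k, ⟨hy, hk⟩, rfl⟩
  have inter : ∀ a w : Subgroup G, a ≤ K → ∀ w' : Subgroup G', w = w'.comap f ⊓ K →
      a.map f ⊓ w' ≤ (a ⊓ w).map f := by
    rintro a w ha w' rfl y ⟨⟨k, hk, rfl⟩, hy⟩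
    exact ⟨k, ⟨hk, hy, ha hk⟩, rfl⟩
  refine ⟨map_mono h.le, fun x z hxz hz => ?_, fun y z hMz hy hz => ?_⟩
  · obtain ⟨x', hx'⟩ : ∃ x', x' = x.comap f ⊓ K := ⟨_, rfl⟩
    obtain ⟨z', hz'⟩ : ∃ z', z' = z.comap f ⊓ K := ⟨_, rfl⟩
    have hx'K : x' ≤ K := hx' ▸ inf_le_right
    have hxz' : x' ≤ z' := hx' ▸ hz' ▸ inf_le_inf_right _ (comap_mono hxz)
    have ex : x'.map f = x := hx' ▸ key x (hxz.trans hz)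
    have ez : z'.map f = z := hz' ▸ key z hz
    calc (x ⊔ M.map f) ⊓ z = (x' ⊔ M).map f ⊓ z := by rw [Subgroup.map_sup, ex]
      _ ≤ ((x' ⊔ M) ⊓ z').map f := inter _ _ (sup_le hx'K h.le) _ hz'
      _ ≤ (x' ⊔ (M ⊓ z')).map f := map_mono (h.2.1 _ _ hxz' (hz' ▸ inf_le_right))
      _ ≤ x ⊔ M.map f ⊓ z := by
          rw [Subgroup.map_sup, ex]
          exact sup_le_sup_left (le_inf (map_mono inf_le_left)
            ((map_mono inf_le_right).trans ez.le)) _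
  · obtain ⟨y', hy'⟩ : ∃ y', y' = y.comap f ⊓ K := ⟨_, rfl⟩
    obtain ⟨z', hz'⟩ : ∃ z', z' = z.comap f ⊓ K := ⟨_, rfl⟩
    have hy'K : y' ≤ K := hy' ▸ inf_le_right
    have hMz' : M ≤ z' := hz' ▸ le_inf (map_le_iff_le_comap.1 hMz) h.le
    have ey : y'.map f = y := hy' ▸ key y hy
    have ez : z'.map f = z := hz' ▸ key z hz
    calc (M.map f ⊔ y) ⊓ z = (M ⊔ y').map f ⊓ z := by rw [Subgroup.map_sup, ey]
      _ ≤ ((M ⊔ y') ⊓ z').map f := inter _ _ (sup_le h.le hy'K) _ hz'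
      _ ≤ (M ⊔ (y' ⊓ z')).map f := map_mono (h.2.2 _ _ hMz' hy'K (hz' ▸ inf_le_right))
      _ ≤ M.map f ⊔ y ⊓ z := by
          rw [Subgroup.map_sup]
          exact sup_le_sup_left (le_inf ((map_mono inf_le_left).trans ey.le)
            ((map_mono inf_le_right).trans ez.le)) _

/-- Preimages of modular subgroups under homomorphisms are modular in the preimage. -/
lemma comap {M K : Subgroup G'} (h : ModularIn M K) (f : G →* G') :
    ModularIn (M.comap f) (K.comap f) := by
  -- Replacing `M`, `K` by their intersections with the range does not change the preimages.
  have hr := h.inf f.range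
  have eM : (M.comap f).map f = M ⊓ f.range := by
    rw [Subgroup.map_comap_eq, inf_comm]
  have eK : (K.comap f).map f = K ⊓ f.range := by
    rw [Subgroup.map_comap_eq, inf_comm]
  have hker : f.ker ≤ M.comap f := f.comap_bot ▸ comap_mono bot_le
  -- Membership can be tested after applying `f` once the kernel is absorbed.
  have absorb : ∀ (g : G) (A Z : Subgroup G), g ∈ Z → A ≤ Z → f g ∈ A.map f →
      g ∈ A ⊔ (f.ker ⊓ Z) := by
    rintro g A Z hg hA ⟨a, ha, e⟩
    have h1 : a⁻¹ * g ∈ f.ker ⊓ Z :=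
      ⟨by simp [e], Z.mul_mem (Z.inv_mem (hA ha)) hg⟩
    have := mul_mem (le_sup_left (b := f.ker ⊓ Z) ha) (le_sup_right (a := A) h1)
    simpa using this
  refine ⟨comap_mono h.le, fun x z hxz hz => ?_, fun y z hMz hy hz => ?_⟩
  · rintro g ⟨hg, hgz⟩
    have hz' : z.map f ≤ K ⊓ f.range := eK ▸ map_mono hz
    have h1 : f g ∈ (x ⊔ M.comap f ⊓ z).map f := by
      have h2 : f g ∈ (x.map f ⊔ (M ⊓ f.range)) ⊓ z.map f := by
        rw [← eM, ← Subgroup.map_sup]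
        exact ⟨mem_map_of_mem f hg, mem_map_of_mem f hgz⟩
      have h3 := hr.2.1 _ _ (map_mono hxz) hz' h2
      rw [Subgroup.map_sup]
      have h5 : (M ⊓ f.range) ⊓ z.map f ≤ (M.comap f ⊓ z).map f := by
        rintro _ ⟨⟨hm, -⟩, ⟨k, hk, rfl⟩⟩
        exact ⟨k, ⟨hm, hk⟩, rfl⟩
      exact (sup_le_sup_left h5 _) h3
    have h4 := absorb g _ z hgz (sup_le hxz inf_le_right) h1
    refine (sup_le le_rfl (le_trans ?_ le_sup_right) : _ ≤ x ⊔ M.comap f ⊓ z) h4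
    exact inf_le_inf_right _ hker
  · rintro g ⟨hg, hgz⟩
    have hz' : z.map f ≤ K ⊓ f.range := eK ▸ map_mono hz
    have hy' : y.map f ≤ K ⊓ f.range := eK ▸ map_mono hy
    have h1 : f g ∈ (M.comap f ⊔ y ⊓ z).map f := by
      have h2 : f g ∈ ((M ⊓ f.range) ⊔ y.map f) ⊓ z.map f := by
        rw [← eM, ← Subgroup.map_sup]
        exact ⟨mem_map_of_mem f hg, mem_map_of_mem f hgz⟩
      have h3 := hr.2.2 _ _ (eM ▸ map_mono hMz) hy' hz' h2
      rw [Subgroup.map_sup, eM]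
      have h5 : y.map f ⊓ z.map f ≤ (y ⊓ z).map f := by
        rintro _ ⟨⟨u, hu, rfl⟩, ⟨k, hk, e⟩⟩
        refine ⟨u, ⟨hu, ?_⟩, rfl⟩
        have : u * k⁻¹ ∈ z := hMz (hker (by simp [e]))
        simpa using z.mul_mem this hk
      exact (sup_le_sup_left h5 _) h3
    have h4 := absorb g _ z hgz (sup_le hMz inf_le_right) h1
    exact (sup_le le_rfl (inf_le_left.trans (hker.trans le_sup_left)) :
      _ ≤ M.comap f ⊔ y ⊓ z) h4

lemma conj_smul (h : ModularIn M K) (g : G) :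
    ModularIn (MulAut.conj g • M) (MulAut.conj g • K) :=
  h.map (MulAut.conj g).toMonoidHom

lemma conj_smul_top (h : ModularIn M ⊤) (g : G) : ModularIn (MulAut.conj g • M) ⊤ := by
  simpa using h.conj_smul g

end ModularIn

lemma modularIn_top_iff {M : Subgroup G} : ModularIn M ⊤ ↔ IsModularSubgroup M := by
  refine ⟨fun h => ⟨fun x z hxz => h.sup_inf hxz le_top,
    fun y z hz => h.sup_inf' hz le_top le_top⟩, fun h => ⟨le_top, fun x z hxz _ => (h.1 x z hxz).le,
      fun y z hz _ _ => (h.2 y z hz).le⟩⟩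

lemma ModularIn.of_normal (M : Subgroup G) [M.Normal] : ModularIn M ⊤ := by
  refine ⟨le_top, fun x z hxz _ => ?_, fun y z hMz _ _ => ?_⟩
  · rintro g ⟨hg, hgz⟩
    obtain ⟨a, ha, m, hm, rfl⟩ := mem_sup_of_normal_right.1 hg
    have : m ∈ z := by simpa using z.mul_mem (z.inv_mem (hxz ha)) hgz
    exact mul_mem_sup ha ⟨hm, this⟩
  · rintro g ⟨hg, hgz⟩
    obtain ⟨m, hm, a, ha, rfl⟩ := mem_sup_of_normal_left.1 hg
    have : a ∈ z := by simpa using z.mul_mem (z.inv_mem (hMz hm)) hgz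
    exact mul_mem_sup hm ⟨ha, this⟩

lemma modularIn_iff {M K : Subgroup G} :
    ModularIn M K ↔ M ≤ K ∧ IsModularSubgroup (M.subgroupOf K) := by
  rw [← modularIn_top_iff]
  constructor
  · intro h
    refine ⟨h.le, ?_⟩
    have := h.comap K.subtype
    rwa [← subgroupOf, ← subgroupOf, subgroupOf_self] at this
  · rintro ⟨h1, h2⟩
    have := h2.map K.subtype
    rwa [subgroupOf_map_subtype, ← MonoidHom.range_eq_map, range_subtype,
      inf_eq_left.2 h1] at this

lemma ModularIn.of_le_normalizer {M K : Subgroup G} (h : M ≤ K)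
    (h' : K ≤ normalizer (M : Set G)) : ModularIn M K := by
  have : (M.subgroupOf K).Normal := (normal_subgroupOf_iff_le_normalizer h).2 h'
  exact modularIn_iff.2 ⟨h, modularIn_top_iff.1 (.of_normal _)⟩

namespace SubmodularIn

variable {H K L : Subgroup G}

lemma le (h : SubmodularIn H K) : H ≤ K := by
  induction h with
  | refl => exact le_rfl
  | tail _ h ih => exact ih.trans h.le

lemma trans (h : SubmodularIn H K) (h' : SubmodularIn K L) : SubmodularIn H L :=
  Relation.ReflTransGen.trans h h'

lemma refl (H : Subgroup G) : SubmodularIn H H := Relation.ReflTransGen.refl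

lemma _root_.Subgroup.ModularIn.submodularIn (h : ModularIn H K) : SubmodularIn H K :=
  Relation.ReflTransGen.single h

lemma map (h : SubmodularIn H K) (f : G →* G') : SubmodularIn (H.map f) (K.map f) :=
  Relation.ReflTransGen.lift (Subgroup.map f) (fun _ _ h => h.map f) _ _ h

lemma comap {H K : Subgroup G'} (h : SubmodularIn H K) (f : G →* G') :
    SubmodularIn (H.comap f) (K.comap f) :=
  Relation.ReflTransGen.lift (Subgroup.comap f) (fun _ _ h => h.comap f) _ _ h

end SubmodularIn

lemma submodularIn_top_iff {H : Subgroup G} : SubmodularIn H ⊤ ↔ IsSubmodular H := by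
  constructor
  · intro h
    induction h using Relation.ReflTransGen.head_induction_on with
    | refl => exact ⟨0, fun _ => ⊤, rfl, rfl, by simp⟩
    | @head a b h _ ih =>
      obtain ⟨n, c, h0, hn, hc⟩ := ih
      refine ⟨n + 1, fun i => Nat.casesOn i a c, rfl, hn, fun i hi => ?_⟩
      cases i with
      | zero => rw [← h0] at h; exact modularIn_iff.1 h
      | succ i => exact hc i (by omega)
  · rintro ⟨n, c, rfl, hn, hc⟩
    rw [← hn]
    have : ∀ m ≤ n, SubmodularIn (c 0) (c m) := by
      intro m
      induction m with
      | zero => intro _; exact .refl _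
      | succ m ih =>
        intro hm
        exact (ih (by omega)).trans (modularIn_iff.2 (hc m (by omega))).submodularIn
    exact this n le_rfl

lemma isSubmodular_subgroupOf_iff {H K : Subgroup G} (h : H ≤ K) :
    IsSubmodular (H.subgroupOf K) ↔ SubmodularIn H K := by
  rw [← submodularIn_top_iff]
  constructor
  · intro h'
    have := h'.map K.subtype
    rwa [subgroupOf_map_subtype, ← MonoidHom.range_eq_map, range_subtype,
      inf_eq_left.2 h] at this
  · intro h'
    have := h'.comap K.subtype
    rwa [← subgroupOf, ← subgroupOf, subgroupOf_self] at this

end Subgroup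

/-! ### Elements of prime power order -/

namespace Subgroup

variable {G : Type*} [Group G]

/-- A subgroup containing all elements of prime power order is the whole group. -/
lemma eq_top_of_forall_primePow [Finite G] (H : Subgroup G)
    (h : ∀ (g : G) (r k : ℕ), r.Prime → orderOf g = r ^ k → g ∈ H) : H = ⊤ := by
  rw [← index_eq_one]
  by_contra hne
  obtain ⟨r, hr, hdvd⟩ := Nat.exists_prime_and_dvd hne
  have : Fact r.Prime := ⟨hr⟩
  let S : Sylow r G := default
  have hS : (S : Subgroup G) ≤ H := fun g hg => by
    obtain ⟨k, hk⟩ := IsPGroup.iff_orderOf.1 S.isPGroup' ⟨g, hg⟩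
    exact h g r k hr (by simpa using hk)
  exact S.not_dvd_index (hdvd.trans (index_dvd_of_le hS))

lemma mem_of_pow_mem_of_coprime {H : Subgroup G} {g : G} {n : ℕ} (hn : (orderOf g).Coprime n)
    (h : g ^ n ∈ H) : g ∈ H := by
  obtain ⟨m, hm⟩ := exists_pow_eq_self_of_coprime hn.symm
  rw [← hm]
  exact H.pow_mem h m

lemma inf_zpowers_le_zpowers_pow {K : Subgroup G} {z : G} {r k : ℕ} (hr : r.Prime)
    (hz : orderOf z = r ^ k) (hzK : z ∉ K) : K ⊓ zpowers z ≤ zpowers (z ^ r) := by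
  rintro w ⟨hwK, hw⟩
  have hfin : IsOfFinOrder z := orderOf_pos_iff.1 (hz ▸ pow_pos hr.pos k)
  obtain ⟨j, rfl⟩ := hfin.mem_powers_iff_mem_zpowers.2 hw
  simp only at hwK hw ⊢
  by_cases hj : r ∣ j
  · obtain ⟨i, rfl⟩ := hj
    rw [pow_mul]
    exact pow_mem (mem_zpowers _) i
  · refine absurd (mem_of_pow_mem_of_coprime ?_ hwK) hzK
    rw [hz]
    exact Nat.Coprime.pow_left _ ((Nat.Prime.coprime_iff_not_dvd hr).2 hj)

lemma mul_pow_mem_mul_pow {M : Subgroup G} {m t : G} (hm : m ∈ M)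
    (ht : t ∈ normalizer (M : Set G)) (n : ℕ) : (m * t) ^ n * (t ^ n)⁻¹ ∈ M := by
  induction n with
  | zero => simp
  | succ n ih =>
    have h1 : t ^ n * m * (t ^ n)⁻¹ ∈ M := (mem_normalizer_iff.1 (pow_mem ht n) m).1 hm
    have h2 := mul_mem ih h1
    convert h2 using 1
    rw [pow_succ, pow_succ]
    group

lemma pow_mem_of_mem_sup_zpowers {M : Subgroup G} {y w : G} {n : ℕ} (hy : y ^ n ∈ M)
    (hyM : y ∈ normalizer (M : Set G)) (hw : w ∈ M ⊔ zpowers y) : w ^ n ∈ M := by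
  have hle : zpowers y ≤ normalizer (M : Set G) := zpowers_le.2 hyM
  rw [← SetLike.mem_coe, coe_mul_of_right_le_normalizer_left _ _ hle] at hw
  obtain ⟨m, hm, t, ht, rfl⟩ := hw
  have h := mul_pow_mem_mul_pow hm (hle ht) n
  obtain ⟨j, rfl⟩ := ht
  have h1 : (y ^ j) ^ n ∈ M := by
    rw [← zpow_natCast, zpow_comm, zpow_natCast]
    exact zpow_mem hy j
  simpa using mul_mem h h1

/-! ### Maximal modular subgroups -/

/-- `M` is maximal among the proper modular subgroups of the group. -/
def IsMaximalModular (M : Subgroup G) : Prop :=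
  Maximal (fun M : Subgroup G => ModularIn M ⊤ ∧ M ≠ ⊤) M

lemma exists_isMaximalModular_ge [Finite G] {M : Subgroup G} (h : ModularIn M ⊤) (hM : M ≠ ⊤) :
    ∃ M', M ≤ M' ∧ IsMaximalModular M' :=
  (Set.toFinite {M : Subgroup G | ModularIn M ⊤ ∧ M ≠ ⊤}).exists_le_maximal ⟨h, hM⟩

lemma SubmodularIn.exists_isMaximalModular [Finite G] {H : Subgroup G} (h : SubmodularIn H ⊤)
    (hH : H ≠ ⊤) : ∃ M, IsMaximalModular M ∧ SubmodularIn H M := by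
  induction h using Relation.ReflTransGen.head_induction_on with
  | refl => exact absurd rfl hH
  | @head a b hab _ ih =>
    by_cases hb : b = ⊤
    · subst hb
      obtain ⟨M, hle, hM⟩ := exists_isMaximalModular_ge hab hH
      exact ⟨M, hM, (hab.mono hle le_top).submodularIn⟩
    · obtain ⟨M, hM, hbM⟩ := ih hb
      exact ⟨M, hM, hab.submodularIn.trans hbM⟩

lemma mem_conj_smul {M : Subgroup G} {g x : G} :
    x ∈ MulAut.conj g • M ↔ g⁻¹ * x * g ∈ M := by
  rw [mem_pointwise_smul_iff_inv_smul_mem, ← map_inv, MulAut.smul_def, MulAut.conj_apply, inv_inv]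

lemma conj_smul_eq_iff_mem_normalizer {M : Subgroup G} {g : G} :
    MulAut.conj g • M = M ↔ g ∈ normalizer (M : Set G) := by
  rw [mem_normalizer_iff, SetLike.ext_iff]
  constructor
  · intro h x
    rw [← h (g * x * g⁻¹), mem_conj_smul]
    simp [mul_assoc]
  · intro h x
    rw [mem_conj_smul, h]
    simp [mul_assoc]

lemma card_conj_smul (M : Subgroup G) (g : G) :
    Nat.card (MulAut.conj g • M : Subgroup G) = Nat.card M :=
  (Nat.card_congr (equivSMul (MulAut.conj g) M).toEquiv).symm

lemma conj_smul_eq_of_le [Finite G] {M : Subgroup G} {g : G} (h : MulAut.conj g • M ≤ M) :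
    MulAut.conj g • M = M :=
  eq_of_le_of_card_ge h (card_conj_smul M g).ge

/-- A maximal modular subgroup which is not normal is a maximal subgroup.

If `z ∉ N(M)` then `⟨M, Mᶻ⟩ = G` by maximality, so `⟨M, z⟩ = G` and `N(M)` is a maximal subgroup.
For `z` of order a power of `r` the interval `[M, G]` is a chain, and `N(M) = ⟨M, z ^ r⟩`. If this
were larger than `M` then `r` would not depend on `z`, so `M` would contain all `r'`-elements
and `G / M_G` would be an `r`-group, where all maximal subgroups are normal. -/
theorem IsMaximalModular.isCoatom [Finite G] {M : Subgroup G} (h : IsMaximalModular M)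
    (hn : ¬ M.Normal) : IsCoatom M := by
  obtain ⟨⟨hmod, hne⟩, hmax⟩ := h
  obtain ⟨N, hN⟩ : ∃ N, N = normalizer (M : Set G) := ⟨_, rfl⟩
  have hMN : M ≤ N := hN ▸ le_normalizer
  have hNtop : N ≠ ⊤ := fun e => hn (normalizer_eq_top_iff.1 (hN ▸ e))
  have gen : ∀ z ∉ N, M ⊔ zpowers z = ⊤ := by
    intro z hz
    have hne' : MulAut.conj z • M ≠ M := fun e => hz (hN ▸ conj_smul_eq_iff_mem_normalizer.1 e)
    have hsup : M ⊔ MulAut.conj z • M = ⊤ := by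
      by_contra hs
      have h1 := hmax ⟨hmod.sup (hmod.conj_smul_top z), hs⟩ le_sup_left
      have h2 : MulAut.conj z • M ≤ M := le_sup_right.trans h1
      exact hne' (conj_smul_eq_of_le h2)
    rw [eq_top_iff, ← hsup]
    refine sup_le le_sup_left ?_
    rintro _ ⟨m, hm, rfl⟩
    have hz' : z ∈ M ⊔ zpowers z := le_sup_right (a := M) (mem_zpowers z)
    have hm' : m ∈ M ⊔ zpowers z := le_sup_left (b := zpowers z) hm
    simpa using mul_mem (mul_mem hz' hm') (inv_mem hz')
  have hNco : IsCoatom N := by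
    refine ⟨hNtop, fun W hW => ?_⟩
    obtain ⟨w, hwW, hwN⟩ := SetLike.exists_of_lt hW
    rw [eq_top_iff, ← gen w hwN]
    exact sup_le (hMN.trans hW.le) (zpowers_le.2 hwW)
  have step : ∀ (z : G) (r k : ℕ), r.Prime → orderOf z = r ^ k → z ∉ N →
      z ^ r ∈ N ∧ N = M ⊔ zpowers (z ^ r) := by
    intro z r k hr hz hzN
    have hle : zpowers (z ^ r) ≤ zpowers z := zpowers_le.2 (pow_mem (mem_zpowers z) r)
    have hzr : z ^ r ∈ N := by
      by_contra hzr
      have h1 := hmod.sup_inf hle le_top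
      rw [sup_comm, gen _ hzr, top_inf_eq] at h1
      have h2 := inf_zpowers_le_zpowers_pow hr hz (fun hh => hzN (hMN hh))
      rw [sup_eq_left.2 h2] at h1
      have h3 : z ∈ zpowers (z ^ r) := h1 ▸ mem_zpowers z
      have h4 : k ≠ 0 := by
        rintro rfl
        rw [pow_zero, orderOf_eq_one_iff] at hz
        exact hzN (hz ▸ N.one_mem)
      have h5 := orderOf_dvd_of_mem_zpowers h3
      rw [orderOf_pow_of_dvd hr.ne_zero (hz ▸ dvd_pow_self r h4), hz] at h5
      have h6 := Nat.le_of_dvd (Nat.div_pos (Nat.le_of_dvd (pow_pos hr.pos k)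
        (dvd_pow_self r h4)) hr.pos) h5
      exact absurd h6 (not_le.2 (Nat.div_lt_self (pow_pos hr.pos k) hr.one_lt))
    refine ⟨hzr, le_antisymm ?_ (sup_le hMN (zpowers_le.2 hzr))⟩
    have h1 := hmod.sup_inf' (y := zpowers z) hMN le_top le_top
    rw [gen z hzN, top_inf_eq] at h1
    rw [h1, inf_comm]
    exact sup_le_sup_left (inf_zpowers_le_zpowers_pow hr hz hzN) _
  obtain ⟨z, p, k, hp, hz, hzN⟩ : ∃ (z : G) (p k : ℕ), p.Prime ∧ orderOf z = p ^ k ∧ z ∉ N := by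
    by_contra hcon
    push Not at hcon
    exact hNtop (eq_top_of_forall_primePow N hcon)
  obtain ⟨hzp, hNeq⟩ := step z p k hp hz hzN
  by_cases hzM : z ^ p ∈ M
  · rw [sup_eq_left.2 (zpowers_le.2 hzM)] at hNeq
    exact hNeq ▸ hNco
  exfalso
  have hfact : Fact p.Prime := ⟨hp⟩
  -- `N / M` is a `p`-group.
  have powM : ∀ w ∈ N, w ^ p ^ k ∈ M := by
    intro w hw
    refine pow_mem_of_mem_sup_zpowers (y := z ^ p) ?_ (hN ▸ hzp) (hNeq ▸ hw)
    rw [← pow_mul, mul_comm, pow_mul, ← hz, pow_orderOf_eq_one, one_pow]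
    exact M.one_mem
  have memM : ∀ (w : G) (r l : ℕ), r.Prime → r ≠ p → orderOf w = r ^ l → w ∈ N → w ∈ M := by
    intro w r l hr hrp hw hwN
    refine mem_of_pow_mem_of_coprime ?_ (powM w hwN)
    rw [hw]
    exact Nat.Coprime.pow _ _ ((Nat.coprime_primes hr hp).2 hrp)
  have memM' : ∀ (w : G) (r l : ℕ), r.Prime → r ≠ p → orderOf w = r ^ l → w ∈ M := by
    intro w r l hr hrp hw
    by_cases hwN : w ∈ N
    · exact memM w r l hr hrp hw hwN
    exfalso
    obtain ⟨hwr, hNeq'⟩ := step w r l hr hw hwN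
    -- Otherwise `N / M` would be generated by the `r`-element `w ^ r`, which lies in `M`.
    obtain ⟨l', hl'⟩ : ∃ l', orderOf (w ^ r) = r ^ l' := by
      obtain ⟨l', -, e⟩ := (Nat.dvd_prime_pow hr).1 (hw ▸ orderOf_pow_dvd (x := w) r)
      exact ⟨l', e⟩
    have h1 := memM _ r l' hr hrp hl' hwr
    rw [sup_eq_left.2 (zpowers_le.2 h1)] at hNeq'
    exact hzM (hNeq' ▸ hzp)
  let K : Subgroup G := closure {w | ∃ r l : ℕ, r.Prime ∧ r ≠ p ∧ orderOf w = r ^ l}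
  have hKM : K ≤ M := by
    rw [closure_le]
    rintro w ⟨r, l, hr, hrp, hw⟩
    exact memM' w r l hr hrp hw
  have hKn : K.Normal := by
    refine ⟨fun w hw g => ?_⟩
    induction hw using closure_induction with
    | mem w hw =>
      obtain ⟨r, l, hr, hrp, hw⟩ := hw
      refine subset_closure ⟨r, l, hr, hrp, ?_⟩
      rw [← hw]
      exact orderOf_injective (MulAut.conj g).toMonoidHom (MulAut.conj g).injective w
    | one => simp
    | mul a b _ _ ha hb => simpa using mul_mem ha hb
    | inv a _ ha => simpa [mul_assoc] using inv_mem ha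
  let S : Sylow p G := default
  have hKS : K ⊔ (S : Subgroup G) = ⊤ := by
    rw [← index_eq_one]
    by_contra hne1
    obtain ⟨r, hr, hdvd⟩ := Nat.exists_prime_and_dvd hne1
    have : Fact r.Prime := ⟨hr⟩
    by_cases hrp : r = p
    · subst hrp
      exact S.not_dvd_index (hdvd.trans (index_dvd_of_le le_sup_right))
    · let T : Sylow r G := default
      have hT : (T : Subgroup G) ≤ K := fun g hg => by
        obtain ⟨l, hl⟩ := IsPGroup.iff_orderOf.1 T.isPGroup' ⟨g, hg⟩
        exact subset_closure ⟨r, l, hr, hrp, by simpa using hl⟩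
      exact T.not_dvd_index (hdvd.trans (index_dvd_of_le (hT.trans le_sup_left)))
  have hq : IsPGroup p (G ⧸ K) := by
    refine S.isPGroup'.of_surjective ((QuotientGroup.mk' K).comp (S : Subgroup G).subtype) ?_
    intro x
    obtain ⟨g, rfl⟩ := QuotientGroup.mk'_surjective K x
    have hg : g ∈ K ⊔ (S : Subgroup G) := hKS ▸ mem_top g
    obtain ⟨a, ha, s, hs, rfl⟩ := mem_sup_of_normal_left.1 hg
    refine ⟨⟨s, hs⟩, ?_⟩
    have : QuotientGroup.mk' K a = 1 := (QuotientGroup.eq_one_iff a).2 ha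
    simp only [MonoidHom.comp_apply, map_mul, this, one_mul]
    rfl
  have hnil : Group.IsNilpotent (G ⧸ K) := hq.isNilpotent
  have hMmap : M.map (QuotientGroup.mk' K) ≠ ⊤ := by
    intro e
    have h1 := congrArg (comap (QuotientGroup.mk' K)) e
    rw [comap_map_eq, QuotientGroup.ker_mk', comap_top, sup_eq_left.2 hKM] at h1
    exact hne h1
  obtain ⟨C, hC, hMC⟩ := (eq_top_or_exists_le_coatom _).resolve_left hMmap
  have hCn : C.Normal :=
    NormalizerCondition.normal_of_coatom _ Group.normalizerCondition_of_isNilpotent hC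
  have hCn' : (C.comap (QuotientGroup.mk' K)).Normal := inferInstance
  have hle : M ≤ C.comap (QuotientGroup.mk' K) := map_le_iff_le_comap.1 hMC
  have hCtop : C.comap (QuotientGroup.mk' K) ≠ ⊤ := by
    intro e
    refine hC.1 (comap_injective (QuotientGroup.mk'_surjective K) (e.trans ?_))
    rw [comap_top]
  have := le_antisymm hle (hmax ⟨.of_normal _, hCtop⟩ hle)
  exact hn (this ▸ hCn')

/-- If `M` is both modular and maximal, every subgroup not contained in `M` meets it in a
maximal subgroup. -/
lemma ModularIn.inf_covBy {M X : Subgroup G} (h : ModularIn M ⊤) (hc : IsCoatom M)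
    (hX : ¬ X ≤ M) : M ⊓ X ⋖ X := by
  refine ⟨lt_of_le_of_ne inf_le_right fun e => hX (e ▸ inf_le_left), fun W h1 h2 => ?_⟩
  have hW : ¬ W ≤ M := fun hh => h1.not_ge (le_inf hh h2.le)
  have e := h.sup_inf h2.le le_top
  rw [hc.2 _ (lt_of_le_of_ne le_sup_right fun e => hW (e ▸ le_sup_left)), top_inf_eq,
    sup_eq_left.2 h1.le] at e
  exact h2.ne e.symm

end Subgroup

/-! ### Orders of products, conjugate subgroups and normalizers -/

namespace Subgroup

variable {G G' : Type*} [Group G] [Group G']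

/-- The product formula `|A B| |A ∩ B| = |A| |B|`. -/
lemma card_mul_mul_card_inf (A B : Subgroup G) :
    Nat.card ((A : Set G) * (B : Set G) : Set G) * Nat.card (A ⊓ B : Subgroup G) =
      Nat.card A * Nat.card B := by
  have h1 := card_mul_eq_card_subgroup_mul_card_quotient B (A : Set G)
  have h2 : MulAction.orbit A ((1 : G) : G ⧸ B) = (fun x : G => (x : G ⧸ B)) '' (A : Set G) := by
    ext x
    constructor
    · rintro ⟨a, rfl⟩
      exact ⟨a, a.2, by change _ = (((a : G) * 1 : G) : G ⧸ B); simp⟩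
    · rintro ⟨a, ha, rfl⟩
      exact ⟨⟨a, ha⟩, by change (((a : G) * 1 : G) : G ⧸ B) = _; simp⟩
  have h3 : MulAction.stabilizer A ((1 : G) : G ⧸ B) = (A ⊓ B).subgroupOf A := by
    ext x
    rw [MulAction.mem_stabilizer_iff, mem_subgroupOf]
    change (((x : G) * 1 : G) : G ⧸ B) = _ ↔ _
    rw [eq_comm, QuotientGroup.eq]
    simp
  have h4 := MulAction.index_stabilizer A ((1 : G) : G ⧸ B)
  rw [h2, h3, ← Nat.card_coe_set_eq] at h4
  have h5 : Nat.card (A ⊓ B : Subgroup G) * ((A ⊓ B).subgroupOf A).index = Nat.card A := by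
    rw [← card_mul_index ((A ⊓ B).subgroupOf A),
      Nat.card_congr (subgroupOfEquivOfLe (inf_le_left : A ⊓ B ≤ A)).toEquiv]
  rw [h1, ← h5, h4]
  ring

lemma isCoatom_conj_smul {M : Subgroup G} (hM : IsCoatom M) (g : G) :
    IsCoatom (MulAut.conj g • M) := by
  refine ⟨fun e => hM.1 ?_, fun W hW => ?_⟩
  · rwa [smul_eq_iff_eq_inv_smul, ← map_inv, Normal.conj_smul_eq_self] at e
  · have h1 : M < (MulAut.conj g)⁻¹ • W := by
      refine lt_of_le_of_ne (pointwise_smul_subset_iff.1 hW.le) fun e => hW.ne ?_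
      rw [e, smul_inv_smul]
    have h2 := hM.2 _ h1
    rw [inv_smul_eq_iff] at h2
    simpa using h2

/-- Normalizers grow in `p`-groups. -/
lemma exists_mem_normalizer_notMem {p : ℕ} [Fact p.Prime] [Finite G] {E P : Subgroup G}
    (hP : IsPGroup p P) (hEP : E ≤ P) (hPE : ¬ P ≤ E) :
    ∃ u ∈ P, u ∉ E ∧ u ∈ normalizer (E : Set G) := by
  have hnil : Group.IsNilpotent P := hP.isNilpotent
  have hlt : E.subgroupOf P < ⊤ := by
    rwa [lt_top_iff_ne_top, Ne, subgroupOf_eq_top]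
  obtain ⟨u, hu, huE⟩ := SetLike.exists_of_lt (Group.normalizerCondition_of_isNilpotent _ hlt)
  refine ⟨u, u.2, fun h => huE (mem_subgroupOf.2 h), ?_⟩
  rw [mem_normalizer_iff] at hu ⊢
  intro x
  by_cases hx : x ∈ P
  · simpa [mem_subgroupOf] using hu ⟨x, hx⟩
  · refine iff_of_false (fun h => hx (hEP h)) fun h => hx ?_
    simpa [mul_assoc] using mul_mem (mul_mem (inv_mem u.2) (hEP h)) u.2

/-! ### The largest normal `p`-subgroup -/

/-- The largest normal `p`-subgroup `O_p(K)` of a subgroup `K`, as a subgroup of the ambient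
group. -/
def pCore (p : ℕ) (K : Subgroup G) : Subgroup G :=
  (⨆ N : {N : Subgroup K // N.Normal ∧ IsPGroup p N}, (N : Subgroup K)).map K.subtype

lemma pCore_le (p : ℕ) (K : Subgroup G) : pCore p K ≤ K := map_subtype_le _

lemma isPGroup_pCore (p : ℕ) [Fact p.Prime] [Finite G] (K : Subgroup G) :
    IsPGroup p (pCore p K) := by
  have : ∀ N : {N : Subgroup K // N.Normal ∧ IsPGroup p N}, (N : Subgroup K).Normal :=
    fun N => N.2.1
  exact (Sylow.iSup_of_normal _ fun N => N.2.2).map _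

lemma le_normalizer_pCore (p : ℕ) (K : Subgroup G) :
    K ≤ normalizer (pCore p K : Set G) := by
  have : ∀ N : {N : Subgroup K // N.Normal ∧ IsPGroup p N}, (N : Subgroup K).Normal :=
    fun N => N.2.1
  have h : ((pCore p K).subgroupOf K).Normal := by
    rw [pCore, subgroupOf, comap_map_eq_self_of_injective K.subtype_injective]
    infer_instance
  exact (normal_subgroupOf_iff_le_normalizer (pCore_le p K)).1 h

lemma le_pCore {p : ℕ} {N K : Subgroup G} (h : N ≤ K) (h' : K ≤ normalizer (N : Set G))
    (hN : IsPGroup p N) : N ≤ pCore p K := by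
  have h1 : (N.subgroupOf K).Normal := (normal_subgroupOf_iff_le_normalizer h).2 h'
  have h2 : IsPGroup p (N.subgroupOf K) := hN.comap_subtype
  rw [← inf_eq_left.2 h, ← subgroupOf_map_subtype]
  exact map_mono (le_iSup (fun N : {N : Subgroup K // N.Normal ∧ IsPGroup p N} =>
    (N : Subgroup K)) ⟨_, h1, h2⟩)

lemma comap_pCore_le {p : ℕ} [Fact p.Prime] [Finite G'] {K : Subgroup G'} {f : G →* G'}
    (hf : Function.Injective f) :
    (pCore p K).comap f ≤ pCore p (K.comap f) := by
  refine le_pCore (comap_mono (pCore_le p K)) ?_ ((isPGroup_pCore p K).comap_of_injective f hf)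
  exact (comap_mono (le_normalizer_pCore p K)).trans (le_normalizer_comap f)

variable {p : ℕ} [Fact p.Prime] [Finite G]

lemma map_pCore_le (K : Subgroup G) (f : G →* G') :
    (pCore p K).map f ≤ pCore p (K.map f) := by
  refine le_pCore (map_mono (pCore_le p K)) ?_ ((isPGroup_pCore p K).map f)
  exact (map_mono (le_normalizer_pCore p K)).trans (le_normalizer_map f)

lemma pCore_conj_smul (K : Subgroup G) (g : G) :
    pCore p (MulAut.conj g • K) = MulAut.conj g • pCore p K := by
  refine le_antisymm ?_ (map_pCore_le K (MulAut.conj g).toMonoidHom)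
  have h := map_pCore_le (p := p) (MulAut.conj g • K) (MulAut.conj g⁻¹).toMonoidHom
  change MulAut.conj g⁻¹ • pCore p (MulAut.conj g • K) ≤
    pCore p (MulAut.conj g⁻¹ • MulAut.conj g • K) at h
  rw [smul_smul, ← map_mul, inv_mul_cancel, map_one, one_smul, map_inv] at h
  exact subset_pointwise_smul_iff.2 h

instance normal_pCore_top : (pCore p (⊤ : Subgroup G)).Normal :=
  normalizer_eq_top_iff.1 (top_le_iff.1 (le_normalizer_pCore p ⊤))

lemma pCore_le_pCore_top_of_normal (L : Subgroup G) [L.Normal] :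
    pCore p L ≤ pCore p (⊤ : Subgroup G) := by
  refine le_pCore le_top (fun g _ => ?_) (isPGroup_pCore p L)
  rw [← conj_smul_eq_iff_mem_normalizer, ← pCore_conj_smul, Normal.conj_smul_eq_self]

lemma card_prime_of_bot_covBy {G : Type*} [Group G] [Finite G] {X : Subgroup G} (h : ⊥ ⋖ X) :
    (Nat.card X).Prime := by
  have hne : Nat.card X ≠ 1 := fun e => h.ne ((card_eq_one.1 e).symm)
  obtain ⟨r, hr, hdvd⟩ := Nat.exists_prime_and_dvd hne
  have : Fact r.Prime := ⟨hr⟩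
  obtain ⟨x, hx⟩ := exists_prime_orderOf_dvd_card' r hdvd
  have hx' : orderOf (x : G) = r := by rw [orderOf_coe, hx]
  have hle : zpowers (x : G) ≤ X := zpowers_le.2 x.2
  rcases hle.lt_or_eq with hlt | heq
  · refine absurd hlt (h.2 (bot_lt_iff_ne_bot.2 fun e => ?_))
    rw [zpowers_eq_bot.1 e, orderOf_one] at hx'
    exact hr.one_lt.ne hx'
  · rwa [← heq, Nat.card_zpowers, hx']

end Subgroup

/-! ### Core-free modular maximal subgroups -/

namespace Subgroup

variable {G : Type*} [Group G] {p : ℕ} {M : Subgroup G}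

/-- `M` is a core-free modular maximal subgroup, not normal, which is minimal with
`O_p(M) ≰ O_p(G)`: inside proper subgroups `K` of `G` the `p`-core of a modular subgroup of `K`
lies in `O_p(K)`. No such `M` exists if `p` is the largest prime divisor of `|G|`, see
`PCoreCounterexample.false_of_le`. -/
structure PCoreCounterexample (p : ℕ) (M : Subgroup G) : Prop where
  modular : ModularIn M ⊤
  coatom : IsCoatom M
  not_normal : ¬ M.Normal
  core : M.normalCore = ⊥
  proper : ∀ K L : Subgroup G, K ≠ ⊤ → ModularIn L K → pCore p L ≤ pCore p K
  not_le : ¬ pCore p M ≤ pCore p (⊤ : Subgroup G)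

/-- If `O_p(M)` lies in a proper normal subgroup `L`, then it lies in `O_p(M ∩ L)`, hence in
`O_p(L)` by the hypothesis on proper subgroups, hence in `O_p(G)`. -/
lemma pCore_le_pCore_top_of_le_normal [Finite G] [Fact p.Prime] {L : Subgroup G} [L.Normal]
    (hM : ModularIn M ⊤)
    (proper : ∀ K L : Subgroup G, K ≠ ⊤ → ModularIn L K → pCore p L ≤ pCore p K)
    (h : pCore p M ≤ L) (hL : L ≠ ⊤) : pCore p M ≤ pCore p (⊤ : Subgroup G) := by
  have h1 : pCore p M ≤ pCore p (M ⊓ L) :=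
    le_pCore (le_inf (pCore_le p M) h) (inf_le_left.trans (le_normalizer_pCore p M))
      (isPGroup_pCore p M)
  have h2 : ModularIn (M ⊓ L) L := by simpa using hM.inf L
  exact (h1.trans (proper L _ hL h2)).trans (pCore_le_pCore_top_of_normal L)

namespace PCoreCounterexample

lemma normalizer_eq (h : PCoreCounterexample p M) : normalizer (M : Set G) = M := by
  by_contra hne
  exact h.not_normal (normalizer_eq_top_iff.1
    (h.coatom.2 _ (lt_of_le_of_ne le_normalizer (Ne.symm hne))))

lemma isCoatom_conj (h : PCoreCounterexample p M) (g : G) : IsCoatom (MulAut.conj g • M) :=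
  isCoatom_conj_smul h.coatom g

lemma exists_notMem (h : PCoreCounterexample p M) : ∃ g, g ∉ M := by
  by_contra hcon
  push Not at hcon
  exact h.coatom.1 (eq_top_iff.2 fun g _ => hcon g)

lemma pCore_ne_bot (h : PCoreCounterexample p M) : pCore p M ≠ ⊥ :=
  fun e => h.not_le (e ▸ bot_le)

lemma conj_covBy (h : PCoreCounterexample p M) {g : G} {X : Subgroup G}
    (hX : ¬ X ≤ MulAut.conj g • M) : (MulAut.conj g • M) ⊓ X ⋖ X :=
  (h.modular.conj_smul_top g).inf_covBy (h.isCoatom_conj g) hX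

variable [Finite G]

lemma conj_ne (h : PCoreCounterexample p M) {g : G} (hg : g ∉ M) :
    ¬ M ≤ MulAut.conj g • M := by
  intro hle
  have h1 : MulAut.conj g • M = M :=
    (eq_of_le_of_card_ge hle (card_conj_smul M g).le).symm
  rw [conj_smul_eq_iff_mem_normalizer, h.normalizer_eq] at h1
  exact hg h1

variable [Fact p.Prime]

lemma eq_top_of_le_normal (h : PCoreCounterexample p M) {L : Subgroup G} [L.Normal]
    (hL : pCore p M ≤ L) : L = ⊤ := by
  by_contra hne
  exact h.not_le (pCore_le_pCore_top_of_le_normal h.modular h.proper hL hne)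

lemma normalizer_pCore_eq (h : PCoreCounterexample p M) :
    normalizer (pCore p M : Set G) = M := by
  by_contra hne
  have h1 := h.coatom.2 _ (lt_of_le_of_ne (le_normalizer_pCore p M) (Ne.symm hne))
  exact h.not_le (le_pCore le_top h1.ge (isPGroup_pCore p M))

lemma pCore_not_le_conj (h : PCoreCounterexample p M) {g : G} (hg : g ∉ M) :
    ¬ pCore p M ≤ MulAut.conj g • M := by
  intro hle
  have h1 : pCore p M ≤ pCore p (M ⊓ MulAut.conj g • M) :=
    le_pCore (le_inf (pCore_le p M) hle) (inf_le_left.trans (le_normalizer_pCore p M))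
      (isPGroup_pCore p M)
  have h2 : ModularIn (M ⊓ MulAut.conj g • M) (MulAut.conj g • M) := by
    simpa using h.modular.inf (MulAut.conj g • M)
  have h3 := h1.trans (h.proper _ _ (h.isCoatom_conj g).1 h2)
  rw [pCore_conj_smul] at h3
  have h4 : MulAut.conj g • pCore p M = pCore p M :=
    (eq_of_le_of_card_ge h3 (card_conj_smul _ g).le).symm
  rw [conj_smul_eq_iff_mem_normalizer, h.normalizer_pCore_eq] at h4
  exact hg h4

/-- If `g ∉ M`, then `E = O_p(M) ∩ Mᵍ` equals `O_p(M) ∩ O_p(M)ᵍ` and is normalized by `M`.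
The first assertion follows from the hypothesis on the proper subgroup `Mᵍ`, in which `M ∩ Mᵍ` is
modular. For the second, the normalizer of `E` contains `M ∩ Mᵍ`, which is maximal in `M`, and an
element of `O_p(M)` outside of it. -/
lemma pCore_inf_conj_aux (h : PCoreCounterexample p M) {g : G} (hg : g ∉ M) :
    pCore p M ⊓ MulAut.conj g • M = pCore p M ⊓ MulAut.conj g • pCore p M ∧
      M ≤ normalizer ((pCore p M ⊓ MulAut.conj g • pCore p M : Subgroup G) : Set G) := by
  obtain ⟨E, hE⟩ : ∃ E, E = pCore p M ⊓ MulAut.conj g • M := ⟨_, rfl⟩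
  obtain ⟨D, hD⟩ : ∃ D, D = M ⊓ MulAut.conj g • M := ⟨_, rfl⟩
  have hED : E ≤ D := by rw [hE, hD]; exact inf_le_inf_right _ (pCore_le p M)
  have hDE : D ≤ normalizer (E : Set G) := by
    rw [hE, hD]
    refine le_trans (inf_le_inf ?_ ?_) inf_normalizer_le_normalizer_inf
    · exact le_normalizer_pCore p M
    · exact le_normalizer
  have hEp : IsPGroup p E := (isPGroup_pCore p M).to_le (hE ▸ inf_le_left)
  have hmod : ModularIn D (MulAut.conj g • M) := by
    simpa [hD] using h.modular.inf (MulAut.conj g • M)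
  have h1 : E ≤ MulAut.conj g • pCore p M := by
    rw [← pCore_conj_smul]
    exact (le_pCore hED hDE hEp).trans (h.proper _ _ (h.isCoatom_conj g).1 hmod)
  have h2 : E = pCore p M ⊓ MulAut.conj g • pCore p M := by
    refine le_antisymm (le_inf (hE ▸ inf_le_left) h1) ?_
    rw [hE]
    exact inf_le_inf_left _ (pointwise_smul_le_pointwise_smul_iff.2 (pCore_le p M))
  refine ⟨hE ▸ h2, h2 ▸ ?_⟩
  obtain ⟨u, hu, huE, hun⟩ := exists_mem_normalizer_notMem (isPGroup_pCore p M)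
    (hE ▸ inf_le_left : E ≤ pCore p M)
    fun hh => h.pCore_not_le_conj hg (hh.trans (hE ▸ inf_le_right))
  have huD : u ∉ D := by
    intro hh
    refine huE ?_
    rw [hE]
    exact ⟨hu, (hD ▸ inf_le_right : D ≤ MulAut.conj g • M) hh⟩
  have hcov : D ⋖ M := by
    rw [hD, inf_comm]
    exact h.conj_covBy (h.conj_ne hg)
  have h5 : D ≤ normalizer (E : Set G) ⊓ M := le_inf hDE hcov.le
  have h6 : D < normalizer (E : Set G) ⊓ M :=
    lt_of_le_of_ne h5 fun e => huD (by rw [e]; exact ⟨hun, pCore_le p M hu⟩)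
  have h7 := (hcov.eq_or_eq h5 inf_le_right).resolve_left h6.ne'
  exact inf_eq_right.1 h7

/-- `O_p(M)` meets the other conjugates of `M` trivially: the intersection with `Mᵍ` is normalized
by `M` and, by symmetry, by `Mᵍ`, hence by `G`, while `M` is core-free. -/
lemma pCore_inf_conj (h : PCoreCounterexample p M) {g : G} (hg : g ∉ M) :
    pCore p M ⊓ MulAut.conj g • M = ⊥ := by
  obtain ⟨h1, h2⟩ := h.pCore_inf_conj_aux hg
  obtain ⟨-, h3⟩ := h.pCore_inf_conj_aux (g := g⁻¹) (by simpa using hg)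
  obtain ⟨E, hE⟩ : ∃ E, E = pCore p M ⊓ MulAut.conj g • pCore p M := ⟨_, rfl⟩
  rw [← hE] at h1 h2
  have h4 : MulAut.conj g • M ≤ normalizer (E : Set G) := by
    have h5 := (map_mono (f := (MulAut.conj g).toMonoidHom) h3).trans (le_normalizer_map _)
    have h6 : MulAut.conj g • (pCore p M ⊓ MulAut.conj g⁻¹ • pCore p M) = E := by
      rw [smul_inf, smul_smul, ← map_mul, mul_inv_cancel, map_one, one_smul, hE, inf_comm]
    rw [← h6]
    exact h5
  have h7 : normalizer (E : Set G) = ⊤ := by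
    by_contra hne
    have h8 := h.coatom.le_iff.1 h2
    rcases h8 with h8 | h8
    · exact hne h8
    · rw [h8] at h4
      have h9 : MulAut.conj g • M = M := conj_smul_eq_of_le h4
      rw [conj_smul_eq_iff_mem_normalizer, h.normalizer_eq] at h9
      exact hg h9
  have hn : E.Normal := normalizer_eq_top_iff.1 h7
  have h10 : E ≤ M.normalCore :=
    normal_le_normalCore.2 (hE ▸ inf_le_left.trans (pCore_le p M))
  rw [h1, ← le_bot_iff, ← h.core]
  exact h10

/-- Every nontrivial element `u` generates `O_p(M)`, by the modular law for `⟨u⟩ ≤ O_p(M)` and a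
conjugate of `M`, which meets `O_p(M)` trivially. -/
lemma zpowers_eq_pCore (h : PCoreCounterexample p M) {u : G} (hu : u ∈ pCore p M) (hu1 : u ≠ 1) :
    zpowers u = pCore p M := by
  obtain ⟨g, hg⟩ := h.exists_notMem
  have hle : zpowers u ≤ pCore p M := zpowers_le.2 hu
  have h1 := (h.modular.conj_smul_top g).sup_inf hle le_top
  have h2 : zpowers u ⊔ MulAut.conj g • M = ⊤ := by
    refine (h.isCoatom_conj g).2 _ (lt_of_le_of_ne le_sup_right fun e => hu1 ?_)
    have h3 : u ∈ pCore p M ⊓ MulAut.conj g • M :=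
      ⟨hu, by rw [e]; exact le_sup_left (a := zpowers u) (mem_zpowers u)⟩
    rwa [h.pCore_inf_conj hg, mem_bot] at h3
  rw [h2, top_inf_eq, inf_comm, h.pCore_inf_conj hg, sup_bot_eq] at h1
  exact h1.symm

lemma card_pCore (h : PCoreCounterexample p M) : Nat.card (pCore p M) = p := by
  have hne : Nat.card (pCore p M) ≠ 1 := fun e => h.pCore_ne_bot (card_eq_one.1 e)
  obtain ⟨x, hx⟩ := exists_prime_orderOf_dvd_card' p
    (((isPGroup_pCore p M).card_eq_or_dvd).resolve_left hne)
  have hx' : orderOf (x : G) = p := by rw [orderOf_coe, hx]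
  rw [← h.zpowers_eq_pCore x.2, Nat.card_zpowers, hx']
  intro e
  rw [e, orderOf_one] at hx'
  exact (Fact.out : p.Prime).one_lt.ne hx'

lemma pCore_sup_inf_conj (h : PCoreCounterexample p M) {g : G} (hg : g ∉ M) :
    pCore p M ⊔ (M ⊓ MulAut.conj g • M) = M := by
  have hcov : M ⊓ MulAut.conj g • M ⋖ M := by
    rw [inf_comm]
    exact h.conj_covBy (h.conj_ne hg)
  refine (hcov.eq_or_eq le_sup_right (sup_le (pCore_le p M) inf_le_left)).resolve_left fun e => ?_
  have h1 : pCore p M ≤ M ⊓ MulAut.conj g • M := by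
    rw [← e]; exact le_sup_left
  exact h.pCore_not_le_conj hg (h1.trans inf_le_right)

lemma exists_mul_of_mem (h : PCoreCounterexample p M) {g c : G} (hg : g ∉ M) (hc : c ∈ M) :
    ∃ u ∈ pCore p M, ∃ d ∈ M ⊓ MulAut.conj g • M, u * d = c := by
  rw [← h.pCore_sup_inf_conj hg, ← SetLike.mem_coe, coe_mul_of_right_le_normalizer_left] at hc
  · exact hc
  · exact inf_le_left.trans (le_normalizer_pCore p M)

/-- `O_p(M)` contains its centralizer: `p`-th powers of elements of the centralizer lie in all
conjugates of `M`, because `M = O_p(M) (M ∩ Mᵍ)` where `O_p(M)` has order `p`. -/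
lemma centralizer_pCore_le (h : PCoreCounterexample p M) :
    centralizer (pCore p M : Set G) ≤ pCore p M := by
  have hCM : centralizer (pCore p M : Set G) ≤ M := by
    conv_rhs => rw [← h.normalizer_pCore_eq]
    exact centralizer_le_normalizer _
  refine le_pCore hCM ?_ ?_
  · rw [le_normalizer_iff]
    intro m hm c hc
    rw [mem_centralizer_iff] at hc ⊢
    intro u hu
    have h1 : m⁻¹ * u * m ∈ pCore p M := by
      have := (mem_normalizer_iff.1 (inv_mem (le_normalizer_pCore p M hm)) u).1 hu
      simpa using this
    have h2 := hc _ h1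
    calc u * (m * c * m⁻¹) = m * ((m⁻¹ * u * m) * c) * m⁻¹ := by group
      _ = m * (c * (m⁻¹ * u * m)) * m⁻¹ := by rw [h2]
      _ = m * c * m⁻¹ * u := by group
  · rintro ⟨c, hc⟩
    refine ⟨1, Subtype.ext ?_⟩
    rw [pow_one, SubmonoidClass.coe_pow, coe_one]
    have key : c ^ p ∈ M.normalCore := by
      intro g
      have hcM := hCM hc
      by_cases hg : g⁻¹ ∈ M
      · exact mul_mem (mul_mem ((inv_mem_iff).1 hg) (pow_mem hcM p)) hg
      obtain ⟨u, hu, d, hd, rfl⟩ := h.exists_mul_of_mem hg hcM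
      have hup : u ^ p = 1 := by
        have := pow_card_eq_one' (G := pCore p M) (x := ⟨u, hu⟩)
        rw [h.card_pCore] at this
        exact congrArg Subtype.val this
      have hcomm : Commute u d := by
        have h1 := mem_centralizer_iff.1 hc u hu
        rw [mul_assoc] at h1
        exact mul_left_cancel h1
      rw [hcomm.mul_pow, hup, one_mul]
      have h2 := pow_mem hd.2 p
      have h3 := mem_conj_smul.1 h2
      rwa [inv_inv] at h3
    rw [h.core, mem_bot] at key
    exact key

/-- `M / O_p(M)` has prime order or is trivial. It is isomorphic to `D = M ∩ Mᵍ`, and a conjugate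
of `D` in `M` meets `Mᵍ` trivially, so that the trivial subgroup is maximal in `D`. -/
lemma card_eq (h : PCoreCounterexample p M) :
    ∃ m, Nat.card M = p * m ∧ (m = 1 ∨ m.Prime) := by
  obtain ⟨g, hg⟩ := h.exists_notMem
  obtain ⟨D, hD⟩ : ∃ D, D = M ⊓ MulAut.conj g • M := ⟨_, rfl⟩
  have hDM : D ≤ M := hD ▸ inf_le_left
  have hPD : pCore p M ⊓ D = ⊥ := by
    rw [hD, ← le_bot_iff, ← h.pCore_inf_conj hg]
    exact inf_le_inf_left _ inf_le_right
  refine ⟨Nat.card D, ?_, ?_⟩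
  · have h1 := card_mul_mul_card_inf (pCore p M) D
    rw [hPD, card_bot, mul_one, h.card_pCore, ← coe_mul_of_right_le_normalizer_left _ _
      (hDM.trans (le_normalizer_pCore p M)), hD, h.pCore_sup_inf_conj hg] at h1
    rw [hD]
    exact h1
  · by_cases hbot : D = ⊥
    · exact .inl (by rw [hbot, card_bot])
    right
    obtain ⟨u, hu, hu1⟩ := (pCore p M).bot_or_exists_ne_one.resolve_left h.pCore_ne_bot
    -- `M` is a Frobenius group with complement `D`
    have hfrob : D ⊓ MulAut.conj u • D = ⊥ := by
      rw [eq_bot_iff]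
      rintro d ⟨hd, hd'⟩
      replace hd' := mem_conj_smul.1 hd'
      have h1 : d⁻¹ * u⁻¹ * d ∈ pCore p M := by
        have := (mem_normalizer_iff.1
          (inv_mem (le_normalizer_pCore p M (hDM hd))) u⁻¹).1 (inv_mem hu)
        simpa using this
      have h2 : d⁻¹ * (u⁻¹ * d * u) ∈ pCore p M ⊓ D :=
        ⟨by simpa [mul_assoc] using mul_mem h1 hu, mul_mem (D.inv_mem hd) hd'⟩
      rw [hPD, mem_bot] at h2
      have h3 : u * d = d * u := by
        rw [inv_mul_eq_one] at h2
        nth_rw 1 [h2]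
        group
      have h4 : d ∈ centralizer (pCore p M : Set G) := by
        rw [← h.zpowers_eq_pCore hu hu1, mem_centralizer_iff]
        rintro _ ⟨j, rfl⟩
        exact ((show Commute u d from h3).zpow_left j).eq
      rw [← hPD]
      exact ⟨h.centralizer_pCore_le h4, hd⟩
    have hle : MulAut.conj u • D ≤ M := by
      rw [← conj_smul_eq_self_of_mem (pCore_le p M hu)]
      exact pointwise_smul_le_pointwise_smul_iff.2 hDM
    have hbot' : (MulAut.conj g • M) ⊓ MulAut.conj u • D = ⊥ := by
      rw [eq_bot_iff, ← hfrob, hD]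
      exact le_inf (le_inf (inf_le_right.trans (hD ▸ hle)) inf_le_left) inf_le_right
    have hnot : ¬ MulAut.conj u • D ≤ MulAut.conj g • M := by
      intro hh
      rw [inf_eq_right.2 hh] at hbot'
      refine hbot (card_eq_one.1 ?_)
      rw [← card_conj_smul D u, hbot', card_bot]
    have h5 := h.conj_covBy hnot
    rw [hbot'] at h5
    rw [← card_conj_smul D u]
    exact card_prime_of_bot_covBy h5

/-- No nontrivial Sylow subgroup for a prime other than `p` lies in the centre of its normalizer:
otherwise, by Burnside's transfer theorem, it has a normal complement, which contains `O_p(M)`. -/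
lemma not_normalizer_le_centralizer (h : PCoreCounterexample p M) {l : ℕ} [Fact l.Prime]
    (hlp : l ≠ p) (hl : l ∣ Nat.card G) (L : Sylow l G) :
    ¬ normalizer (L : Set G) ≤ centralizer (L : Set G) := by
  intro hL
  have hle : pCore p M ≤ (MonoidHom.transferSylow L hL).ker := by
    intro u hu
    rw [MonoidHom.mem_ker]
    by_contra hne
    have h1 : p ∣ orderOf (MonoidHom.transferSylow L hL u) := by
      have h2 : orderOf (MonoidHom.transferSylow L hL u) ∣ p := by
        refine (orderOf_map_dvd _ u).trans ?_
        rw [← h.card_pCore]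
        exact (pCore p M).orderOf_dvd_natCard hu
      rcases (Nat.dvd_prime Fact.out).1 h2 with h3 | h3
      · exact absurd (orderOf_eq_one_iff.1 h3) hne
      · rw [h3]
    obtain ⟨k, hk⟩ := IsPGroup.iff_orderOf.1 L.isPGroup' (MonoidHom.transferSylow L hL u)
    rw [hk] at h1
    have := (Nat.prime_dvd_prime_iff_eq Fact.out Fact.out).1
      ((Fact.out : p.Prime).dvd_of_dvd_pow h1)
    exact hlp this.symm
  have h1 := h.eq_top_of_le_normal hle
  have h2 := MonoidHom.not_dvd_card_ker_transferSylow L hL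
  rw [h1, card_top] at h2
  exact h2 hl

/-- If `p` is the largest prime divisor of `|G|`, there is no `PCoreCounterexample`.

Let `l` be the smallest prime divisor and let `L` be a Sylow `l`-subgroup. If `l ≠ p`, then `L` is
not cyclic, since it would lie in the centre of its normalizer. As `M ∩ L` is maximal in `L` and
`|M|` is `p` or `p m` with `m` prime, `|L| = l ^ 2` and `m = l`. So `L` is abelian, its normalizer
is larger than `L` and contains `M`, and `L` is normal. Then `M ∩ L` centralizes `O_p(M)`, although
`O_p(M)` contains its centralizer. -/
theorem false_of_le (h : PCoreCounterexample p M)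
    (hp : ∀ r : ℕ, r.Prime → r ∣ Nat.card G → r ≤ p) : False := by
  have hG1 : Nat.card G ≠ 1 := fun e => by
    have := (Nat.card_eq_one_iff_unique.1 e).1
    exact h.coatom.1 (Subsingleton.elim _ _)
  obtain ⟨l, hl⟩ : ∃ l, l = (Nat.card G).minFac := ⟨_, rfl⟩
  have hlprime : l.Prime := hl ▸ Nat.minFac_prime hG1
  have : Fact l.Prime := ⟨hlprime⟩
  have hldvd : l ∣ Nat.card G := hl ▸ Nat.minFac_dvd _
  by_cases hlp : l = p
  · -- `G` is a `p`-group, so that the maximal subgroup `M` is normal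
    have h1 : IsPGroup p G := by
      refine (isPGroup_iff_primeFactors_card_subset (Fact.out : p.Prime).ne_zero).2 fun r hr => ?_
      have hr' := Nat.prime_of_mem_primeFactors hr
      have hrd := Nat.dvd_of_mem_primeFactors hr
      have h2 : r = p := le_antisymm (hp r hr' hrd)
        (hlp ▸ hl ▸ Nat.minFac_le_of_dvd hr'.two_le hrd)
      rw [h2, (Fact.out : p.Prime).primeFactors]
      exact Finset.mem_singleton_self p
    have h2 := h1.isNilpotent
    exact h.not_normal (NormalizerCondition.normal_of_coatom _
      Group.normalizerCondition_of_isNilpotent h.coatom)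
  let L : Sylow l G := default
  have hcyc : ¬ IsCyclic L := fun hc =>
    h.not_normalizer_le_centralizer hlp hldvd L (hc.normalizer_le_centralizer hl.symm)
  have hcardL : ¬ (Nat.card L).Prime := fun hh => hcyc
    (have : Fact (Nat.card L).Prime := ⟨hh⟩; isCyclic_of_prime_card rfl)
  obtain ⟨m, hm, hm1⟩ := h.card_eq
  have hdvd : ∀ X : Subgroup G, X ≤ M → IsPGroup l X → Nat.card X = 1 ∨
      (Nat.card X = m ∧ m.Prime) := by
    intro X hXM hX
    have h1 : Nat.card X ∣ p * m := hm ▸ card_dvd_of_le hXM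
    obtain ⟨k, hk⟩ := IsPGroup.iff_card.1 hX
    have h2 : (Nat.card X).Coprime p := by
      rw [hk]; exact Nat.Coprime.pow_left _ ((Nat.coprime_primes hlprime Fact.out).2 hlp)
    have h3 := h2.dvd_of_dvd_mul_left h1
    rcases hm1 with rfl | hm1
    · exact .inl (Nat.dvd_one.1 h3)
    · rcases (Nat.dvd_prime hm1).1 h3 with h4 | h4
      · exact .inl h4
      · exact .inr ⟨h4, hm1⟩
  have hLM : ¬ (L : Subgroup G) ≤ M := by
    intro hle
    rcases hdvd L hle L.isPGroup' with h1 | ⟨h1, h2⟩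
    · have := (Nat.card_eq_one_iff_unique.1 h1).1
      exact hcyc inferInstance
    · exact hcardL (h1 ▸ h2)
  have hcovL := h.modular.inf_covBy h.coatom hLM
  have hQp : IsPGroup l (M ⊓ L : Subgroup G) := L.isPGroup'.to_le inf_le_right
  have hcardQ : Nat.card (M ⊓ L : Subgroup G) = m ∧ m.Prime := by
    refine (hdvd _ inf_le_left hQp).resolve_left fun h1 => ?_
    rw [card_eq_one.1 h1] at hcovL
    exact hcardL (card_prime_of_bot_covBy hcovL)
  have hml : m = l := by
    have h1 := hQp.card_eq_or_dvd
    rw [hcardQ.1] at h1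
    exact ((Nat.prime_dvd_prime_iff_eq hlprime hcardQ.2).1
      (h1.resolve_left hcardQ.2.one_lt.ne')).symm
  subst hml
  -- `L` has order `m ^ 2`: a subgroup of order `m ^ 2` above `M ⊓ L` can only be `L`
  have hcardL2 : Nat.card L = m ^ 2 := by
    obtain ⟨k, hk⟩ := IsPGroup.iff_card.1 L.isPGroup'
    have hlt : Nat.card (M ⊓ L : Subgroup G) < Nat.card L := by
      refine lt_of_le_of_ne (Nat.le_of_dvd Nat.card_pos (card_dvd_of_le inf_le_right)) fun e => ?_
      exact hcovL.ne (eq_of_le_of_card_ge inf_le_right e.ge)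
    have hk2 : 2 ≤ k := by
      by_contra hk2
      have h2 : m ^ k ≤ m ^ 1 := Nat.pow_le_pow_right hlprime.pos (by omega)
      rw [hcardQ.1, hk] at hlt
      rw [pow_one] at h2
      omega
    have hcardQ' : Nat.card ((M ⊓ L : Subgroup G).subgroupOf (L : Subgroup G)) = m ^ 1 := by
      rw [Nat.card_congr (subgroupOfEquivOfLe inf_le_right).toEquiv, hcardQ.1, pow_one]
    obtain ⟨K, hK, hle⟩ := Sylow.exists_subgroup_card_pow_succ
      (show m ^ (1 + 1) ∣ Nat.card L from hk ▸ pow_dvd_pow m hk2) hcardQ'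
    have h3 : Nat.card (K.map (L : Subgroup G).subtype) = m ^ 2 := by
      rw [Nat.card_congr (K.equivMapOfInjective _ (subtype_injective _)).symm.toEquiv, hK]
    have h4 : M ⊓ L ≤ K.map (L : Subgroup G).subtype := by
      have := map_mono (f := (L : Subgroup G).subtype) hle
      rwa [subgroupOf_map_subtype, inf_eq_left.2 inf_le_right] at this
    rcases hcovL.eq_or_eq h4 (map_subtype_le K) with h5 | h5
    · rw [h5, hcardQ.1] at h3
      have h6 : m ^ 1 < m ^ 2 := Nat.pow_lt_pow_right hlprime.one_lt (by norm_num)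
      rw [← h3, pow_one] at h6
      exact absurd h6 (lt_irrefl m)
    · rw [h5] at h3
      exact h3
  have hLcomm : (L : Subgroup G) ≤ centralizer (L : Set G) := by
    have := IsPGroup.isMulCommutative_of_card_eq_prime_sq hcardL2
    intro x hx
    rw [mem_centralizer_iff]
    intro y hy
    exact congrArg Subtype.val (mul_comm' (⟨y, hy⟩ : L) ⟨x, hx⟩)
  obtain ⟨X, hX⟩ : ∃ X, X = normalizer (L : Set G) := ⟨_, rfl⟩
  have hLX : (L : Subgroup G) ≤ X := hX ▸ le_normalizer
  have hcovX := h.modular.inf_covBy h.coatom (fun hh => hLM (hLX.trans hh) : ¬ X ≤ M)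
  have hle : M ⊓ L ≤ M ⊓ X := inf_le_inf_left _ hLX
  have hXL : (M ⊓ X : Subgroup G) ≠ M ⊓ L := by
    intro e
    rw [e] at hcovX
    rcases hcovX.eq_or_eq hcovL.le hLX with h1 | h1
    · exact hcovL.ne h1.symm
    · exact h.not_normalizer_le_centralizer hlp hldvd L (by rw [← hX, ← h1]; exact hLcomm)
  have hMX : M ≤ X := by
    have h1 : Nat.card (M ⊓ L : Subgroup G) ∣ Nat.card (M ⊓ X : Subgroup G) := card_dvd_of_le hle
    have h2 : Nat.card (M ⊓ X : Subgroup G) ∣ p * m := hm ▸ card_dvd_of_le inf_le_left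
    rw [hcardQ.1] at h1
    obtain ⟨t, ht⟩ := h1
    rw [ht, mul_comm p m] at h2
    have h3 := Nat.dvd_of_mul_dvd_mul_left hlprime.pos h2
    have h4 : t = p := by
      refine ((Nat.dvd_prime Fact.out).1 h3).resolve_left fun h4 => ?_
      refine hXL (eq_of_le_of_card_ge hle ?_).symm
      rw [ht, h4, mul_one, hcardQ.1]
    have h5 : M ⊓ X = M := eq_of_le_of_card_ge inf_le_left (by rw [ht, h4, hm, mul_comm])
    exact h5 ▸ inf_le_right
  have hXtop : X = ⊤ := h.coatom.2 _ (lt_of_le_of_ne hMX fun e => hLM (e ▸ hLX))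
  have hLn : (L : Subgroup G).Normal := normalizer_eq_top_iff.1 (hX ▸ hXtop)
  -- hence `M ⊓ L` is normalized by `O_p(M)` and so centralizes it
  have hdisj : pCore p M ⊓ L = ⊥ :=
    (IsPGroup.disjoint_of_ne p m (Ne.symm hlp) _ _ (isPGroup_pCore p M) L.isPGroup').eq_bot
  have hcent : M ⊓ L ≤ centralizer (pCore p M : Set G) := by
    rintro q ⟨hqM, hqL⟩
    rw [mem_centralizer_iff]
    intro u hu
    have h1 : u * q * u⁻¹ * q⁻¹ ∈ pCore p M ⊓ L := by
      refine ⟨?_, mul_mem (hLn.conj_mem q hqL u) ((L : Subgroup G).inv_mem hqL)⟩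
      have := mul_mem hu ((mem_normalizer_iff.1 (le_normalizer_pCore p M hqM) u⁻¹).1 (inv_mem hu))
      simpa [mul_assoc] using this
    rw [hdisj, mem_bot, mul_inv_eq_one, mul_inv_eq_iff_eq_mul] at h1
    exact h1
  have hbot : M ⊓ L ≤ ⊥ := hdisj ▸ le_inf (hcent.trans h.centralizer_pCore_le) inf_le_right
  rw [le_bot_iff.1 hbot, card_bot] at hcardQ
  exact hlprime.one_lt.ne hcardQ.1

end PCoreCounterexample

end Subgroup

/-! ### Modular subgroups and the largest prime divisor -/

namespace Subgroup

universe u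

lemma pCore_le_pCore_of_subgroupOf {G : Type*} [Group G] [Finite G] {p : ℕ} [Fact p.Prime]
    {K L : Subgroup G} (hLK : L ≤ K)
    (h : pCore p (L.subgroupOf K) ≤ pCore p (⊤ : Subgroup K)) : pCore p L ≤ pCore p K := by
  have h2 : (pCore p L).subgroupOf K ≤ pCore p (L.subgroupOf K) :=
    comap_pCore_le K.subtype_injective
  have h3 := (map_mono (f := K.subtype) (h2.trans h)).trans (map_pCore_le _ _)
  rwa [subgroupOf_map_subtype, inf_eq_left.2 ((pCore_le p L).trans hLK),
    ← MonoidHom.range_eq_map, range_subtype] at h3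

/-- Let `p` be at least as large as every prime divisor of `|G|`. Then `O_p(M) ≤ O_p(G)` for
every modular subgroup `M` of `G`. -/
theorem ModularIn.pCore_le_pCore_top {G : Type u} [Group G] [Finite G] {p : ℕ} [Fact p.Prime]
    (hp : ∀ r : ℕ, r.Prime → r ∣ Nat.card G → r ≤ p) {M : Subgroup G} (hM : ModularIn M ⊤) :
    pCore p M ≤ pCore p (⊤ : Subgroup G) := by
  obtain ⟨n, hn⟩ : ∃ n, n = Nat.card G := ⟨_, rfl⟩
  induction n using Nat.strong_induction_on generalizing G with
  | _ n ih =>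
  have proper : ∀ K L : Subgroup G, K ≠ ⊤ → ModularIn L K → pCore p L ≤ pCore p K := by
    intro K L hK hL
    have hlt : Nat.card K < n := by
      rw [hn]
      refine lt_of_le_of_ne (Nat.le_of_dvd Nat.card_pos (card_subgroup_dvd_card K)) fun e => ?_
      exact hK ((card_eq_iff_eq_top K).1 e)
    exact pCore_le_pCore_of_subgroupOf hL.le
      (ih _ hlt (fun r hr hrd => hp r hr (hrd.trans (card_subgroup_dvd_card K)))
        (modularIn_top_iff.2 (modularIn_iff.1 hL).2) rfl)
  by_cases hMtop : M = ⊤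
  · rw [hMtop]
  obtain ⟨M', hMM', hmax⟩ := exists_isMaximalModular_ge hM hMtop
  have hM'mod : ModularIn M' ⊤ := hmax.1.1
  have hM'top : M' ≠ ⊤ := hmax.1.2
  refine (proper M' M hM'top (hM.mono hMM' le_top)).trans ?_
  by_cases hnorm : M'.Normal
  · exact pCore_le_pCore_top_of_normal M'
  have hco := hmax.isCoatom hnorm
  by_contra hnot
  by_cases hcore : M'.normalCore = ⊥
  · exact PCoreCounterexample.false_of_le ⟨hM'mod, hco, hnorm, hcore, proper, hnot⟩ hp
  -- pass to the quotient by the core of `M'`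
  obtain ⟨f, hf⟩ : ∃ f, f = QuotientGroup.mk' M'.normalCore := ⟨_, rfl⟩
  have hker : f.ker = M'.normalCore := hf ▸ QuotientGroup.ker_mk' _
  have hsurj : Function.Surjective f := hf ▸ QuotientGroup.mk'_surjective _
  have hcard : Nat.card (G ⧸ M'.normalCore) < n := by
    rw [hn, ← index_eq_card, ← card_mul_index M'.normalCore]
    have h1 : Nat.card M'.normalCore ≠ 1 := fun e => hcore (card_eq_one.1 e)
    have h2 : 0 < Nat.card M'.normalCore := Nat.card_pos
    have h3 : 0 < M'.normalCore.index := Nat.pos_of_ne_zero index_ne_zero_of_finite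
    nlinarith [Nat.lt_of_le_of_ne h2 (Ne.symm h1)]
  have h1 : pCore p (M'.map f) ≤ pCore p (⊤ : Subgroup (G ⧸ M'.normalCore)) := by
    refine ih _ hcard (fun r hr hrd => hp r hr (hrd.trans ?_)) ?_ rfl
    · rw [← index_eq_card]; exact index_dvd_card _
    · simpa [map_top_of_surjective f hsurj] using hM'mod.map f
  have h2 : pCore p M' ≤ (pCore p (⊤ : Subgroup (G ⧸ M'.normalCore))).comap f :=
    map_le_iff_le_comap.1 ((map_pCore_le M' f).trans h1)
  by_cases htop : (pCore p (⊤ : Subgroup (G ⧸ M'.normalCore))).comap f = ⊤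
  · have h3 : pCore p (⊤ : Subgroup (G ⧸ M'.normalCore)) = ⊤ :=
      comap_injective hsurj (htop.trans (comap_top f).symm)
    have h4 : IsPGroup p (G ⧸ M'.normalCore) := by
      have := isPGroup_pCore p (⊤ : Subgroup (G ⧸ M'.normalCore))
      rw [h3] at this
      exact this.of_equiv topEquiv
    have h5 := h4.isNilpotent
    have hback : (M'.map f).comap f = M' := by
      rw [comap_map_eq, hker, sup_eq_left.2 M'.normalCore_le]
    have hco' : IsCoatom (M'.map f) := by
      refine ⟨fun e => hM'top ?_, fun W hW => comap_injective hsurj ?_⟩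
      · rw [← hback, e, comap_top]
      · rw [comap_top]
        refine hco.2 _ (lt_of_le_of_ne ?_ fun e => hW.ne ?_)
        · exact hback.ge.trans (comap_mono hW.le)
        · exact (congrArg (Subgroup.map f) e).trans (map_comap_eq_self_of_surjective hsurj W)
    have h6 := NormalizerCondition.normal_of_coatom _
      Group.normalizerCondition_of_isNilpotent hco'
    have h7 : ((M'.map f).comap f).Normal := h6.comap f
    exact hnorm (hback ▸ h7)
  · exact hnot (pCore_le_pCore_top_of_le_normal hM'mod proper h2 htop)

/-- Let `p` be at least as large as every prime divisor of `|G|`. Then every submodular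
`p`-subgroup of `G` lies in `O_p(G)`. -/
theorem SubmodularIn.le_pCore_top {G : Type u} [Group G] [Finite G] {p : ℕ} [Fact p.Prime]
    (hp : ∀ r : ℕ, r.Prime → r ∣ Nat.card G → r ≤ p) {H : Subgroup G} (hH : SubmodularIn H ⊤)
    (hHp : IsPGroup p H) : H ≤ pCore p (⊤ : Subgroup G) := by
  have key : ∀ K, SubmodularIn H K → H ≤ pCore p K := by
    intro K hK
    induction hK with
    | refl => exact le_pCore le_rfl le_normalizer hHp
    | @tail L K _ hLK ih =>
      refine ih.trans ?_
      exact pCore_le_pCore_of_subgroupOf hLK.le (ModularIn.pCore_le_pCore_top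
        (fun r hr hrd => hp r hr (hrd.trans (card_subgroup_dvd_card K)))
        (modularIn_top_iff.2 (modularIn_iff.1 hLK).2))
  exact key ⊤ hH

end Subgroup

/-! ### The action of submodular `q`-subgroups on normal `p`-subgroups -/

namespace Subgroup

universe u

/-- `x ^ q` centralizes `P`, and `x` itself does unless `q ∣ p - 1`. The notion is meant for a
`q`-element `x` normalizing a `p`-group `P`, where `p ≠ q` are primes, but none of this is part of
the definition. -/
def ActsTamely {G : Type*} [Group G] (q p : ℕ) (P : Subgroup G) (x : G) : Prop :=
  (∀ u ∈ P, Commute (x ^ q) u) ∧ (q ∣ p - 1 ∨ ∀ u ∈ P, Commute x u)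

variable {p q : ℕ}

lemma conj_pow_eq_pow_pow {G : Type*} [Group G] {x v : G} {j : ℕ} (h : x * v * x⁻¹ = v ^ j)
    (n : ℕ) : x ^ n * v * (x ^ n)⁻¹ = v ^ j ^ n := by
  induction n with
  | zero => simp
  | succ n ih =>
    calc x ^ (n + 1) * v * (x ^ (n + 1))⁻¹ = x ^ n * (x * v * x⁻¹) * (x ^ n)⁻¹ := by
          rw [pow_succ]; group
      _ = (x ^ n * v * (x ^ n)⁻¹) ^ j := by rw [h, conj_pow]
      _ = v ^ j ^ (n + 1) := by rw [ih, ← pow_mul, pow_succ]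

/-- A `q`-element centralizing both `R` and `P / R`, where `P` is a `p`-group with `p ≠ q`,
centralizes `P`. -/
lemma commute_of_commute_of_mem {G : Type*} [Group G] {p q : ℕ} [Fact p.Prime] [Fact q.Prime]
    (hpq : p ≠ q) {P R : Subgroup G} {z : G} (hR : IsPGroup p R) {k : ℕ} (hz : z ^ q ^ k = 1)
    (h1 : ∀ r ∈ R, Commute z r) (h2 : ∀ u ∈ P, u⁻¹ * (z * u * z⁻¹) ∈ R) :
    ∀ u ∈ P, Commute z u := by
  intro u hu
  obtain ⟨r, hr⟩ : ∃ r, r = u⁻¹ * (z * u * z⁻¹) := ⟨_, rfl⟩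
  have hrR : r ∈ R := hr ▸ h2 u hu
  have e : z * u * z⁻¹ = u * r := by rw [hr]; group
  have key : ∀ n : ℕ, z ^ n * u * (z ^ n)⁻¹ = u * r ^ n := by
    intro n
    induction n with
    | zero => simp
    | succ n ih =>
      have h3 : z * r ^ n * z⁻¹ = r ^ n := by
        rw [((h1 r hrR).pow_right n).eq, mul_inv_cancel_right]
      calc z ^ (n + 1) * u * (z ^ (n + 1))⁻¹ = z * (z ^ n * u * (z ^ n)⁻¹) * z⁻¹ := by
            rw [pow_succ']; group
        _ = (z * u * z⁻¹) * (z * r ^ n * z⁻¹) := by rw [ih]; group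
        _ = u * r ^ (n + 1) := by rw [e, h3, pow_succ', mul_assoc]
  have h3 := key (q ^ k)
  rw [hz, one_mul, inv_one, mul_one, eq_comm, mul_eq_left] at h3
  obtain ⟨n, hn⟩ := hR ⟨r, hrR⟩
  have hn' : r ^ p ^ n = 1 := congrArg Subtype.val hn
  have hcop : (p ^ n).Coprime (q ^ k) :=
    Nat.Coprime.pow _ _ ((Nat.coprime_primes Fact.out Fact.out).2 hpq)
  have hr1 : r = 1 := by
    rw [← orderOf_eq_one_iff]
    exact Nat.eq_one_of_dvd_coprimes hcop (orderOf_dvd_of_pow_eq_one hn')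
      (orderOf_dvd_of_pow_eq_one h3)
  rw [hr1, mul_one, mul_inv_eq_iff_eq_mul] at e
  exact e

/-- The elements of a cyclic submodular `q`-subgroup act tamely on the normal `p`-subgroups.

By induction `x` acts tamely on `R = M ∩ P`, where `M` is a maximal modular subgroup in which `⟨x⟩`
is submodular, so by coprime action only `P / R` matters. If it is acted on nontrivially, then `M`
is not normal and does not contain `P`, so `M` is a maximal subgroup, `P / R` has order `p`, and the
kernel of the action of `M` on `P / R` is the intersection of two conjugates of `M`, a maximal
subgroup of `M`. So `x` induces an automorphism of order dividing `q` of a group of order `p`. -/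
theorem SubmodularIn.actsTamely {G : Type u} [Group G] [Finite G] [Fact p.Prime] [Fact q.Prime]
    (hpq : p ≠ q) {P : Subgroup G} [P.Normal] (hP : IsPGroup p P) {x : G} {k : ℕ}
    (hx : x ^ q ^ k = 1) (hsub : SubmodularIn (zpowers x) ⊤) : ActsTamely q p P x := by
  obtain ⟨n, hn⟩ : ∃ n, n = Nat.card G := ⟨_, rfl⟩
  induction n using Nat.strong_induction_on generalizing G with
  | _ n ih =>
  by_cases htop : zpowers x = ⊤
  · -- `G` is cyclic, so abelian
    have : ∀ u, Commute x u := by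
      intro u
      obtain ⟨j, rfl⟩ : u ∈ zpowers x := htop ▸ mem_top u
      exact (Commute.refl x).zpow_right j
    exact ⟨fun u _ => (this u).pow_left q, .inr fun u _ => this u⟩
  obtain ⟨M, hmax, hxM⟩ := hsub.exists_isMaximalModular htop
  have hMmod : ModularIn M ⊤ := hmax.1.1
  have hxmem : x ∈ M := hxM.le (mem_zpowers x)
  obtain ⟨R, hR⟩ : ∃ R, R = M ⊓ P := ⟨_, rfl⟩
  have hRM : R ≤ M := hR ▸ inf_le_left
  have hRP : R ≤ P := hR ▸ inf_le_right
  have hRp : IsPGroup p R := hP.to_le hRP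
  have hIH : ActsTamely q p R x := by
    have hlt : Nat.card M < n := by
      rw [hn]
      refine lt_of_le_of_ne (Nat.le_of_dvd Nat.card_pos (card_subgroup_dvd_card M)) fun e => ?_
      exact hmax.1.2 ((card_eq_iff_eq_top M).1 e)
    have hsub' : SubmodularIn (zpowers (⟨x, hxmem⟩ : M)) ⊤ := by
      have h1 := (isSubmodular_subgroupOf_iff hxM.le).2 hxM
      have h2 : (zpowers x).subgroupOf M = zpowers (⟨x, hxmem⟩ : M) := by
        have h3 : (zpowers (⟨x, hxmem⟩ : M)).map M.subtype = zpowers x := by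
          rw [MonoidHom.map_zpowers]; rfl
        rw [← h3, subgroupOf, comap_map_eq_self_of_injective M.subtype_injective]
      rw [h2] at h1
      exact submodularIn_top_iff.2 h1
    have h1 := ih _ hlt (P := P.subgroupOf M) hP.comap_subtype (x := ⟨x, hxmem⟩)
      (Subtype.ext hx) hsub' rfl
    refine ⟨fun u hu => ?_, h1.2.imp_right fun h u hu => ?_⟩
    · exact congrArg Subtype.val (h1.1 ⟨u, hRM hu⟩ (mem_subgroupOf.2 (hRP hu))).eq
    · exact congrArg Subtype.val (h ⟨u, hRM hu⟩ (mem_subgroupOf.2 (hRP hu))).eq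
  have hxq : (x ^ q) ^ q ^ k = 1 := by rw [← pow_mul, mul_comm, pow_mul, hx, one_pow]
  -- it suffices to control the action on `P / R`
  suffices hsuff : (∀ u ∈ P, u⁻¹ * (x ^ q * u * (x ^ q)⁻¹) ∈ R) ∧
      (q ∣ p - 1 ∨ ∀ u ∈ P, u⁻¹ * (x * u * x⁻¹) ∈ R) by
    refine ⟨commute_of_commute_of_mem hpq hRp hxq hIH.1 hsuff.1, ?_⟩
    rcases hsuff.2 with h | h
    · exact .inl h
    · exact hIH.2.imp_right fun h' => commute_of_commute_of_mem hpq hRp hx h' h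
  by_cases hnorm : M.Normal
  · have key : ∀ z ∈ M, ∀ u ∈ P, u⁻¹ * (z * u * z⁻¹) ∈ R := by
      intro z hz u hu
      rw [hR]
      refine ⟨?_, P.mul_mem (P.inv_mem hu) (Normal.conj_mem inferInstance u hu z)⟩
      have h1 := hnorm.conj_mem z hz u⁻¹
      simpa [mul_assoc] using mul_mem h1 (inv_mem hz)
    exact ⟨key _ (pow_mem hxmem q), .inr (key x hxmem)⟩
  have hco := hmax.isCoatom hnorm
  by_cases hPM : P ≤ M
  · have hRP' : R = P := by rw [hR, inf_eq_right.2 hPM]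
    have key : ∀ z : G, ∀ u ∈ P, u⁻¹ * (z * u * z⁻¹) ∈ R := fun z u hu => hRP' ▸
      P.mul_mem (P.inv_mem hu) (Normal.conj_mem inferInstance u hu z)
    exact ⟨key _, .inr (key x)⟩
  have hPR : ¬ P ≤ R := fun h => hPM (h.trans hRM)
  -- `R` is normalized by `M` and by an element of `P` outside `M`
  have hRnorm : R.Normal := by
    obtain ⟨u, huP, huR, hun⟩ := exists_mem_normalizer_notMem hP hRP hPR
    have h1 : M ≤ normalizer (R : Set G) := by
      rw [hR]
      exact (le_inf le_normalizer (le_normalizer_of_normal)).trans inf_normalizer_le_normalizer_inf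
    have h2 : u ∉ M := fun h => huR (hR ▸ ⟨h, huP⟩)
    exact normalizer_eq_top_iff.1 (hco.2 _ (lt_of_le_of_ne h1 fun e => h2 (e ▸ hun)))
  obtain ⟨v, hvP, hvR, hvp⟩ : ∃ v ∈ P, v ∉ R ∧ v ^ p ∈ R := by
    obtain ⟨u, huP, huR⟩ := SetLike.not_le_iff_exists.1 hPR
    obtain ⟨a, ha⟩ := hP ⟨u, huP⟩
    have hex : ∃ a, u ^ p ^ a ∈ R := ⟨a, by
      have : u ^ p ^ a = 1 := congrArg Subtype.val ha
      rw [this]; exact R.one_mem⟩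
    classical
    obtain ⟨b, hb⟩ : ∃ b, Nat.find hex = b + 1 := Nat.exists_eq_succ_of_ne_zero fun h0 => by
      have := Nat.find_spec hex
      rw [h0, pow_zero, pow_one] at this
      exact huR this
    refine ⟨u ^ p ^ b, pow_mem huP _, Nat.find_min hex (by omega), ?_⟩
    rw [← pow_mul, ← pow_succ, ← hb]
    exact Nat.find_spec hex
  have hvM : v ∉ M := fun h => hvR (hR ▸ ⟨h, hvP⟩)
  obtain ⟨f, hf⟩ : ∃ f, f = QuotientGroup.mk' R := ⟨_, rfl⟩
  have hfR : ∀ g, f g = 1 ↔ g ∈ R := fun g => by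
    rw [hf]; exact QuotientGroup.eq_one_iff g
  have hord : orderOf (f v) = p := orderOf_eq_prime (by rw [← map_pow, hfR]; exact hvp)
    (by rw [Ne, hfR]; exact hvR)
  -- modularity of `M` forces `P / R` to be generated by the image of `v`
  have hPgen : ∀ u ∈ P, f u ∈ zpowers (f v) := by
    intro u hu
    have h1 := hMmod.sup_inf (zpowers_le.2 hvP) le_top
    have h2 : zpowers v ⊔ M = ⊤ := hco.2 _ (lt_of_le_of_ne le_sup_right fun e =>
      hvM (by rw [e]; exact le_sup_left (a := zpowers v) (mem_zpowers v)))
    rw [h2, top_inf_eq, ← hR] at h1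
    rw [h1] at hu
    obtain ⟨_, ⟨j, rfl⟩, r, hr, rfl⟩ := mem_sup_of_normal_right.1 hu
    rw [map_mul, (hfR r).2 hr, mul_one]
    exact ⟨j, by simp⟩
  have comm_iff : ∀ z u : G, Commute (f z) (f u) ↔ u⁻¹ * (z * u * z⁻¹) ∈ R := by
    intro z u
    rw [← hfR, map_mul, map_inv, inv_mul_eq_one, map_mul, map_mul, map_inv, eq_comm,
      mul_inv_eq_iff_eq_mul]
    rfl
  have comm_of : ∀ z, Commute (f z) (f v) → ∀ u ∈ P, u⁻¹ * (z * u * z⁻¹) ∈ R := by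
    intro z hz u hu
    obtain ⟨j, hj⟩ := hPgen u hu
    rw [← comm_iff, ← hj]
    exact hz.zpow_right j
  -- the kernel of the action of `M` on `P / R` is `M ⊓ Mᵛ`, a maximal subgroup of `M`
  obtain ⟨K, hK⟩ : ∃ K, K = MulAut.conj v • M ⊓ M := ⟨_, rfl⟩
  have hmemK : ∀ m ∈ M, m ∈ K ↔ Commute (f m) (f v) := by
    intro m hm
    rw [comm_iff, hK, mem_inf, mem_conj_smul]
    constructor
    · rintro ⟨h, -⟩
      rw [hR]
      refine ⟨?_, P.mul_mem (P.inv_mem hvP) (Normal.conj_mem inferInstance v hvP m)⟩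
      simpa [mul_assoc] using mul_mem h (inv_mem hm)
    · intro h
      refine ⟨?_, hm⟩
      simpa [mul_assoc] using mul_mem (hRM h) hm
  have hKnorm : M ≤ normalizer (K : Set G) := by
    rw [le_normalizer_iff]
    intro m hm c hc
    have hcM : c ∈ M := (hK ▸ inf_le_right : K ≤ M) hc
    rw [hmemK _ (mul_mem (mul_mem hm hcM) (inv_mem hm))]
    have h1 : Commute (f c) (f (m⁻¹ * v * m)) := (comm_iff _ _).2
      (comm_of c ((hmemK c hcM).1 hc) _ (by
        simpa using Normal.conj_mem (inferInstance : P.Normal) v hvP m⁻¹))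
    have h2 := h1.map (MulAut.conj (f m))
    simpa [MulAut.conj_apply, mul_assoc] using h2
  have hcov : K ⋖ M := by
    have h1 : ¬ M ≤ MulAut.conj v • M := by
      intro h
      have h2 : MulAut.conj v • M = M := (eq_of_le_of_card_ge h (card_conj_smul M v).le).symm
      rw [conj_smul_eq_iff_mem_normalizer] at h2
      have h3 : normalizer (M : Set G) = ⊤ := hco.2 _ (lt_of_le_of_ne le_normalizer fun e =>
        hvM (e ▸ h2))
      exact hnorm (normalizer_eq_top_iff.1 h3)
    rw [hK]
    exact (hMmod.conj_smul_top v).inf_covBy (isCoatom_conj_smul hco v) h1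
  by_cases hxK : x ∈ K
  · have h1 := (hmemK x hxmem).1 hxK
    exact ⟨comm_of _ (by rw [map_pow]; exact h1.pow_left q), .inr (comm_of x h1)⟩
  have hxqK : x ^ q ∈ K := by
    have hex : ∃ a, x ^ q ^ a ∈ K := ⟨k, hx ▸ K.one_mem⟩
    classical
    obtain ⟨b, hb⟩ : ∃ b, Nat.find hex = b + 1 := Nat.exists_eq_succ_of_ne_zero fun h0 => by
      have := Nat.find_spec hex
      rw [h0, pow_zero, pow_one] at this
      exact hxK this
    have hyK : x ^ q ^ b ∉ K := Nat.find_min hex (by omega)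
    have hyM : x ^ q ^ b ∈ M := pow_mem hxmem _
    have hyq : (x ^ q ^ b) ^ q ∈ K := by
      rw [← pow_mul, ← pow_succ, ← hb]
      exact Nat.find_spec hex
    have h1 : K ⊔ zpowers (x ^ q ^ b) = M := by
      refine (hcov.eq_or_eq le_sup_left (sup_le hcov.le (zpowers_le.2 hyM))).resolve_left
        fun e => hyK ?_
      rw [← e]
      exact le_sup_right (a := K) (mem_zpowers _)
    exact pow_mem_of_mem_sup_zpowers hyq (hKnorm hyM) (h1 ▸ hxmem)
  have hxqc := (hmemK _ (pow_mem hxmem q)).1 hxqK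
  refine ⟨comm_of _ hxqc, .inl ?_⟩
  -- `x` acts on the group `P / R` of order `p` as an automorphism of order `q`
  have hfin : IsOfFinOrder (f v) := orderOf_pos_iff.1 (hord ▸ (Fact.out : p.Prime).pos)
  obtain ⟨j, hj⟩ : ∃ j : ℕ, f v ^ j = f x * f v * (f x)⁻¹ := by
    have h1 : f (x * v * x⁻¹) ∈ zpowers (f v) :=
      hPgen _ (Normal.conj_mem inferInstance v hvP x)
    obtain ⟨j, hj⟩ := hfin.mem_powers_iff_mem_zpowers.2 h1
    exact ⟨j, by simpa using hj⟩
  have hjq : ((j : ZMod p)) ^ q = 1 := by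
    have h1 := conj_pow_eq_pow_pow hj.symm q
    rw [← map_pow, hxqc.eq, mul_inv_cancel_right] at h1
    have h2 : f v ^ 1 = f v ^ j ^ q := by rw [pow_one]; exact h1
    rw [pow_inj_mod, hord] at h2
    have h3 : ((1 : ℕ) : ZMod p) = ((j ^ q : ℕ) : ZMod p) :=
      (ZMod.natCast_eq_natCast_iff' _ _ _).2 h2
    simpa using h3.symm
  have hj1 : (j : ZMod p) ≠ 1 := by
    intro e
    have h1 : (j : ZMod p) = ((1 : ℕ) : ZMod p) := by simpa using e
    rw [ZMod.natCast_eq_natCast_iff', ← hord, ← pow_inj_mod, pow_one, hj,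
      mul_inv_eq_iff_eq_mul] at h1
    exact hxK ((hmemK x hxmem).2 h1)
  have hj0 : (j : ZMod p) ≠ 0 := by
    intro e
    rw [e, zero_pow (Fact.out : q.Prime).ne_zero] at hjq
    exact zero_ne_one hjq
  rw [← orderOf_eq_prime hjq hj1]
  exact ZMod.orderOf_dvd_card_sub_one hj0

end Subgroup

/-! ### Submodularity of subgroups acting tamely -/

namespace Subgroup

open scoped commutatorElement

universe u

/-- In a group whose order divides a product of two primes, every subgroup is modular. -/
lemma ModularIn.of_card_dvd {G : Type*} [Group G] [Finite G] {p q : ℕ} (hp : p.Prime)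
    (hq : q.Prime) (h : Nat.card G ∣ q * p) (M : Subgroup G) : ModularIn M ⊤ := by
  -- there is no chain of length three in the subgroup lattice
  have key : ∀ X Z : Subgroup G, X < Z → X ≠ ⊥ → Z ≠ ⊤ → False := by
    intro X Z hXZ hX hZ
    have h1 : Nat.card X ≠ 1 := fun e => hX (card_eq_one.1 e)
    have h2 : Z.index ≠ 1 := fun e => hZ (index_eq_one.1 e)
    have h3 : X.relIndex Z ≠ 1 := fun e => hXZ.not_ge (relIndex_eq_one.1 e)
    have e : Nat.card X * (X.relIndex Z * Z.index) = Nat.card G := by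
      rw [relIndex_mul_index hXZ.le, card_mul_index]
    have hpos : 0 < Nat.card X * (X.relIndex Z * Z.index) := e ▸ Nat.card_pos
    obtain ⟨ha, hbc⟩ := CanonicallyOrderedAdd.mul_pos.1 hpos
    obtain ⟨hb, hc⟩ := CanonicallyOrderedAdd.mul_pos.1 hbc
    have pos : ∀ n : ℕ, 0 < n → n ≠ 1 → 1 ≤ ArithmeticFunction.cardFactors n := by
      intro n hn hn1
      rw [Nat.one_le_iff_ne_zero, Ne, ArithmeticFunction.cardFactors_eq_zero_iff_eq_zero_or_one]
      omega
    have h4 := pos _ ha h1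
    have h5 := pos _ hb h3
    have h6 := pos _ hc h2
    obtain ⟨t, ht⟩ := h
    have hqp : q * p ≠ 0 := mul_ne_zero hq.ne_zero hp.ne_zero
    have ht0 : t ≠ 0 := fun h0 => hqp (by rw [ht, h0, mul_zero])
    have h7 := congrArg ArithmeticFunction.cardFactors ht
    rw [← e, ArithmeticFunction.cardFactors_mul hpos.ne' ht0,
      ArithmeticFunction.cardFactors_mul ha.ne' hbc.ne',
      ArithmeticFunction.cardFactors_mul hb.ne' hc.ne',
      ArithmeticFunction.cardFactors_mul hq.ne_zero hp.ne_zero,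
      ArithmeticFunction.cardFactors_apply_prime hp,
      ArithmeticFunction.cardFactors_apply_prime hq] at h7
    omega
  refine ⟨le_top, fun x z hxz _ => ?_, fun y z hMz _ _ => ?_⟩
  · rcases hxz.eq_or_lt with rfl | hlt
    · exact inf_le_right.trans le_sup_left
    by_cases hx : x = ⊥
    · simp [hx]
    by_cases hz : z = ⊤
    · simp [hz]
    · exact (key x z hlt hx hz).elim
  · rcases hMz.eq_or_lt with rfl | hlt
    · exact inf_le_right.trans le_sup_left
    by_cases hx : M = ⊥
    · simp [hx]
    by_cases hz : z = ⊤
    · simp [hz]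
    · exact (key M z hlt hx hz).elim

variable {p q : ℕ} [Fact p.Prime]

/-- An automorphism whose order divides `p - 1` of an elementary abelian `p`-group has an
eigenvector. -/
lemma exists_apply_eq_pow {V : Type*} [CommGroup V] [Finite V] [Nontrivial V]
    (hexp : ∀ v : V, v ^ p = 1) (φ : V →* V) (hφ : ∀ v, φ^[q] v = v) (hq : q ∣ p - 1) :
    ∃ v : V, v ≠ 1 ∧ ∃ j : ℕ, φ v = v ^ j := by
  let _ : Module (ZMod p) (Additive V) := AddCommGroup.zmodModule (n := p) hexp
  have : Module.Finite (ZMod p) (Additive V) := Module.Finite.of_finite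
  let f : Module.End (ZMod p) (Additive V) := AddMonoidHom.toZModLinearMap p φ.toAdditive
  have hf : ∀ n v, (f ^ n) v = Additive.ofMul (φ^[n] v.toMul) := by
    intro n
    induction n with
    | zero => intro v; rfl
    | succ n ih =>
      intro v
      rw [pow_succ, Module.End.mul_apply, ih, Function.iterate_succ_apply]
      rfl
  have hfq : f ^ q = 1 := LinearMap.ext fun v => by rw [hf, hφ]; rfl
  have hfp : f ^ p = f := by
    obtain ⟨c, hc⟩ := hq
    have hp1 : p = q * c + 1 := by
      have := (Fact.out : p.Prime).one_lt
      omega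
    refine (congrArg (f ^ ·) hp1).trans ?_
    simp only [pow_succ, pow_mul, hfq, one_pow, one_mul]
  have hint : IsIntegral (ZMod p) f := Algebra.IsIntegral.isIntegral f
  have hdvd : minpoly (ZMod p) f ∣ Polynomial.X ^ p - Polynomial.X :=
    minpoly.dvd _ _ (by simp [hfp])
  have hspl := (GaloisField.splits_zmod_X_pow_sub_X p).of_dvd
    (FiniteField.X_pow_card_sub_X_ne_zero (ZMod p) (Fact.out : p.Prime).one_lt) hdvd
  obtain ⟨a, ha⟩ := hspl.exists_eval_eq_zero (minpoly.degree_pos hint).ne'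
  obtain ⟨v, hv⟩ := (Module.End.hasEigenvalue_of_isRoot (f := f) ha).exists_hasEigenvector
  refine ⟨v.toMul, fun h => hv.2 h, a.val, ?_⟩
  have h1 : f v = a.val • v := by
    rw [hv.apply_eq_smul, ← Nat.cast_smul_eq_nsmul (ZMod p), ZMod.natCast_zmod_val]
  exact h1

/-- If `G = Q W` where `W` is normal of prime order `p` and all `q`-th powers of elements of `Q`
centralize `W`, then `Q` is modular in `G`: modulo the kernel of the action of `Q` on `W` the
order of the group divides `q p`. -/
lemma ModularIn.of_sup_zpowers {G : Type*} [Group G] [Finite G] [Fact q.Prime] {Q : Subgroup G}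
    {v : G} (hv : orderOf v = p) (hW : (zpowers v).Normal) (htop : Q ⊔ zpowers v = ⊤)
    (hpow : ∀ x ∈ Q, Commute (x ^ q) v) : ModularIn Q ⊤ := by
  obtain ⟨C, hC⟩ : ∃ C, C = Q ⊓ centralizer {v} := ⟨_, rfl⟩
  have hmemC : ∀ x, x ∈ C ↔ x ∈ Q ∧ Commute x v := by
    intro x
    rw [hC, mem_inf, mem_centralizer_singleton_iff]
    rfl
  have hfin : IsOfFinOrder v := orderOf_pos_iff.1 (hv ▸ (Fact.out : p.Prime).pos)
  have act : ∀ x : G, ∃ j : ℕ, x * v * x⁻¹ = v ^ j := by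
    intro x
    obtain ⟨j, hj⟩ := hfin.mem_powers_iff_mem_zpowers.2 (hW.conj_mem v (mem_zpowers v) x)
    exact ⟨j, hj.symm⟩
  have hCn : C.Normal := by
    rw [← normalizer_eq_top_iff, eq_top_iff, ← htop]
    refine sup_le ?_ (zpowers_le.2 ?_)
    · rw [le_normalizer_iff]
      intro x hx c hc
      rw [hmemC] at hc ⊢
      refine ⟨mul_mem (mul_mem hx hc.1) (inv_mem hx), ?_⟩
      obtain ⟨j, hj⟩ := act x⁻¹
      have h1 : Commute c (x⁻¹ * v * x⁻¹⁻¹) := hj ▸ hc.2.pow_right j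
      have h2 := h1.map (MulAut.conj x)
      simpa [MulAut.conj_apply, mul_assoc] using h2
    · rw [mem_normalizer_iff]
      intro c
      constructor
      · intro hc
        have h1 : v * c * v⁻¹ = c := by
          rw [← ((hmemC c).1 hc).2.eq, mul_inv_cancel_right]
        rwa [h1]
      · intro hc
        have h1 : v⁻¹ * (v * c * v⁻¹) * v = v * c * v⁻¹ := by
          have := ((hmemC _).1 hc).2.eq
          rw [mul_assoc, this, inv_mul_cancel_left]
        have h2 : c = v * c * v⁻¹ := by
          rw [← h1]; group
        rwa [h2]
  obtain ⟨f, hf⟩ : ∃ f, f = QuotientGroup.mk' C := ⟨_, rfl⟩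
  have hfC : ∀ g, f g = 1 ↔ g ∈ C := fun g => by
    rw [hf]; exact QuotientGroup.eq_one_iff g
  have hsurj : Function.Surjective f := hf ▸ QuotientGroup.mk'_surjective _
  -- the image of `Q` is cyclic of order dividing `q`
  obtain ⟨x, hx⟩ : ∃ x ∈ Q, Q.map f = zpowers (f x) := by
    by_cases hcomm : ∀ x ∈ Q, Commute x v
    · refine ⟨1, Q.one_mem, ?_⟩
      rw [map_one, zpowers_one_eq_bot, eq_bot_iff, map_le_iff_le_comap]
      intro y hy
      rw [mem_comap, mem_bot, hfC, hmemC]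
      exact ⟨hy, hcomm y hy⟩
    push Not at hcomm
    obtain ⟨x, hxQ, hxv⟩ := hcomm
    refine ⟨x, hxQ, le_antisymm ?_ (zpowers_le.2 (mem_map_of_mem f hxQ))⟩
    have act_pow : ∀ y ∈ Q, ∀ j : ℕ, y * v * y⁻¹ = v ^ j → (j : ZMod p) ^ q = 1 := by
      intro y hy j hj
      have h1 := conj_pow_eq_pow_pow hj q
      rw [(hpow y hy).eq, mul_inv_cancel_right] at h1
      have h2 : v ^ 1 = v ^ j ^ q := by rw [pow_one]; exact h1
      rw [pow_inj_mod, hv] at h2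
      have h3 : ((1 : ℕ) : ZMod p) = ((j ^ q : ℕ) : ZMod p) :=
        (ZMod.natCast_eq_natCast_iff' _ _ _).2 h2
      simpa using h3.symm
    obtain ⟨j, hj⟩ := act x
    have hjq := act_pow x hxQ j hj
    have hj1 : (j : ZMod p) ≠ 1 := by
      intro e
      have h1 : (j : ZMod p) = ((1 : ℕ) : ZMod p) := by simpa using e
      rw [ZMod.natCast_eq_natCast_iff', ← hv, ← pow_inj_mod, pow_one, ← hj,
        mul_inv_eq_iff_eq_mul] at h1
      exact hxv h1
    have hprim : IsPrimitiveRoot (j : ZMod p) q :=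
      orderOf_eq_prime hjq hj1 ▸ IsPrimitiveRoot.orderOf _
    rintro _ ⟨y, hy, rfl⟩
    obtain ⟨i, hi⟩ := act y
    obtain ⟨t, -, ht⟩ := hprim.eq_pow_of_pow_eq_one (act_pow y hy i hi)
    have h1 : v ^ j ^ t = v ^ i := by
      rw [pow_inj_mod, hv, ← ZMod.natCast_eq_natCast_iff']
      simpa using ht
    have h2 := conj_pow_eq_pow_pow hj t
    rw [h1, ← hi] at h2
    have h3 : (x ^ t)⁻¹ * y ∈ C := by
      rw [hmemC]
      refine ⟨mul_mem (inv_mem (pow_mem hxQ t)) hy, ?_⟩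
      have h4 : (x ^ t)⁻¹ * (x ^ t * v * (x ^ t)⁻¹) * y = (x ^ t)⁻¹ * (y * v * y⁻¹) * y := by
        rw [h2]
      have h5 : v * ((x ^ t)⁻¹ * y) = (x ^ t)⁻¹ * y * v := by
        simpa [mul_assoc] using h4
      exact h5.symm
    rw [← hfC, map_mul, map_inv, inv_mul_eq_one] at h3
    rw [← h3, map_pow]
    exact pow_mem (mem_zpowers _) t
  have hcard : Nat.card (G ⧸ C) ∣ q * p := by
    have h1 : (Q.map f : Set (G ⧸ C)) * ((zpowers v).map f : Set (G ⧸ C)) = Set.univ := by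
      have : ((zpowers v).map f).Normal := hW.map f hsurj
      rw [← mul_normal, ← Subgroup.map_sup, htop, map_top_of_surjective f hsurj, coe_top]
    have h2 := card_mul_mul_card_inf (Q.map f) ((zpowers v).map f)
    rw [h1, Nat.card_univ] at h2
    refine (Dvd.intro _ h2).trans (mul_dvd_mul ?_ ?_)
    · rw [hx.2, Nat.card_zpowers]
      refine orderOf_dvd_of_pow_eq_one ?_
      rw [← map_pow, hfC, hmemC]
      exact ⟨pow_mem hx.1 q, hpow x hx.1⟩
    · refine (card_map_dvd _ f).trans ?_
      rw [Nat.card_zpowers, hv]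
  have h1 := (ModularIn.of_card_dvd Fact.out Fact.out hcard (Q.map f)).comap f
  have hker : f.ker ≤ Q := by
    intro g hg
    exact ((hmemC g).1 ((hfC g).1 hg)).1
  rwa [comap_map_eq, sup_eq_left.2 hker, comap_top] at h1

/-- If a group `Q` acts on a nontrivial `p`-group `P` through an abelian group of exponent
dividing a divisor `q` of `p - 1`, then `Q` normalizes a subgroup of order `p` of the centre
of `P`. -/
lemma exists_zpowers_normal {G : Type*} [Group G] [Finite G] {P Q : Subgroup G} [P.Normal]
    (hP : IsPGroup p P) (hPbot : P ≠ ⊥) (htop : Q ⊔ P = ⊤) (hq : q ∣ p - 1)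
    (hpow : ∀ x ∈ Q, ∀ u ∈ P, Commute (x ^ q) u)
    (hcomm : ∀ x ∈ Q, ∀ y ∈ Q, ∀ u ∈ P, Commute ⁅x, y⁆ u) :
    ∃ v ∈ P, orderOf v = p ∧ (zpowers v).Normal := by
  -- the elementary abelian part of the centre of `P`
  let Z : Subgroup G :=
    { carrier := {z | z ∈ P ∧ (∀ u ∈ P, Commute z u) ∧ z ^ p = 1}
      one_mem' := ⟨P.one_mem, fun u _ => Commute.one_left u, one_pow p⟩
      mul_mem' := fun {a b} ha hb => ⟨mul_mem ha.1 hb.1,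
        fun u hu => (ha.2.1 u hu).mul_left (hb.2.1 u hu), by
          rw [(ha.2.1 b hb.1).mul_pow, ha.2.2, hb.2.2, one_mul]⟩
      inv_mem' := fun {a} ha => ⟨inv_mem ha.1, fun u hu => (ha.2.1 u hu).inv_left, by
        rw [inv_pow, ha.2.2, inv_one]⟩ }
  have hZn : Z.Normal := by
    refine ⟨fun z hz g => ⟨Normal.conj_mem inferInstance z hz.1 g, fun u hu => ?_, ?_⟩⟩
    · have h1 : g⁻¹ * u * g ∈ P := by
        simpa using Normal.conj_mem (inferInstance : P.Normal) u hu g⁻¹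
      have h2 := (hz.2.1 _ h1).map (MulAut.conj g)
      simpa [MulAut.conj_apply, mul_assoc] using h2
    · rw [conj_pow, hz.2.2, mul_one, mul_inv_cancel]
  have hZbot : Z ≠ ⊥ := by
    have : Nontrivial P := (nontrivial_iff_ne_bot P).2 hPbot
    have := hP.center_nontrivial
    have hc : IsPGroup p (center P) := hP.to_subgroup _
    have h1 : Nat.card (center P) ≠ 1 := Finite.one_lt_card.ne'
    obtain ⟨z, hz⟩ := exists_prime_orderOf_dvd_card' p (hc.card_eq_or_dvd.resolve_left h1)
    intro e
    have hzZ : ((z : P) : G) ∈ Z := by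
      refine ⟨z.1.2, fun u hu => ?_, ?_⟩
      · exact congrArg Subtype.val (mem_center_iff.1 z.2 ⟨u, hu⟩).symm
      · have h2 : z ^ p = 1 := hz ▸ pow_orderOf_eq_one z
        exact congrArg (fun w : center P => ((w : P) : G)) h2
    rw [e, mem_bot] at hzZ
    have h3 : z = 1 := Subtype.ext (Subtype.ext hzZ)
    rw [h3, orderOf_one] at hz
    exact (Fact.out : p.Prime).one_lt.ne hz
  -- a minimal nontrivial `Q`-invariant subgroup of `Z`
  obtain ⟨W, hW⟩ := (Set.toFinite {W : Subgroup G | W ≠ ⊥ ∧ W ≤ Z ∧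
    Q ≤ normalizer (W : Set G)}).exists_minimal ⟨Z, hZbot, le_rfl, le_normalizer_of_normal⟩
  obtain ⟨⟨hWbot, hWZ, hQW⟩, hmin⟩ := hW
  -- every element of `Q` acts on `W` as a power map
  have scalar : ∀ x ∈ Q, ∃ j : ℕ, ∀ w ∈ W, x * w * x⁻¹ = w ^ j := by
    intro x hx
    let _ : CommGroup W :=
      { (inferInstance : Group W) with
        mul_comm := fun a b => Subtype.ext ((hWZ a.2).2.1 b (hWZ b.2).1).eq }
    have : Nontrivial W := (nontrivial_iff_ne_bot W).2 hWbot
    let φ : W →* W := MonoidHom.mk'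
      (fun w => ⟨x * w * x⁻¹, (mem_normalizer_iff.1 (hQW hx) w).1 w.2⟩)
      (fun a b => Subtype.ext (by simp))
    have hφ : ∀ (n : ℕ) (w : W), ((φ^[n] w : W) : G) = x ^ n * w * (x ^ n)⁻¹ := by
      intro n
      induction n with
      | zero => intro w; simp
      | succ n ih =>
        intro w
        rw [Function.iterate_succ_apply, ih, pow_succ]
        change x ^ n * (x * w * x⁻¹) * (x ^ n)⁻¹ = _
        group
    obtain ⟨v, hv1, j, hj⟩ := exists_apply_eq_pow (p := p) (q := q)
      (fun w : W => Subtype.ext (hWZ w.2).2.2) φ (fun w => Subtype.ext (by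
        rw [hφ, (hpow x hx w (hWZ w.2).1).eq, mul_inv_cancel_right])) hq
    have hj' : x * (v : G) * x⁻¹ = (v : G) ^ j := congrArg Subtype.val hj
    let E : Subgroup G :=
      { carrier := {w | w ∈ W ∧ x * w * x⁻¹ = w ^ j}
        one_mem' := ⟨W.one_mem, by simp⟩
        mul_mem' := fun {a b} ha hb => ⟨mul_mem ha.1 hb.1, by
          rw [((hWZ ha.1).2.1 b (hWZ hb.1).1).mul_pow, ← ha.2, ← hb.2]; group⟩
        inv_mem' := fun {a} ha => ⟨inv_mem ha.1, by rw [inv_pow, ← ha.2]; group⟩ }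
    have hEW : E ≤ W := fun w hw => hw.1
    have hWE : W ≤ E := by
      refine hmin ⟨fun e => hv1 ?_, hEW.trans hWZ, ?_⟩ hEW
      · have h1 : (v : G) ∈ E := ⟨v.2, hj'⟩
        rw [e, mem_bot] at h1
        exact Subtype.ext h1
      · rw [le_normalizer_iff]
        rintro y hy w ⟨hw, hwj⟩
        refine ⟨(mem_normalizer_iff.1 (hQW hy) w).1 hw, ?_⟩
        -- `x` and `y` commute modulo the centralizer of `P`
        have h1 := hcomm x⁻¹ (inv_mem hx) y⁻¹ (inv_mem hy) w (hWZ hw).1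
        have h2 : x⁻¹ * y⁻¹ * x * y * w = w * (x⁻¹ * y⁻¹ * x * y) := by
          have h3 := h1.eq
          simpa [commutatorElement_def] using h3
        calc x * (y * w * y⁻¹) * x⁻¹
            = y * x * (x⁻¹ * y⁻¹ * x * y * w) * y⁻¹ * x⁻¹ := by group
          _ = y * (x * w * x⁻¹) * y⁻¹ := by rw [h2]; group
          _ = (y * w * y⁻¹) ^ j := by rw [hwj, conj_pow]
    exact ⟨j, fun w hw => (hWE hw).2⟩
  obtain ⟨v, hvW, hv1⟩ := W.bot_or_exists_ne_one.resolve_left hWbot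
  have hvZ := hWZ hvW
  refine ⟨v, hvZ.1, orderOf_eq_prime hvZ.2.2 hv1, ?_⟩
  rw [← normalizer_eq_top_iff, eq_top_iff, ← htop]
  refine sup_le ?_ ?_
  · rw [le_normalizer_iff]
    rintro x hx _ ⟨t, rfl⟩
    obtain ⟨j, hj⟩ := scalar x hx
    change x * v ^ t * x⁻¹ ∈ _
    rw [← conj_zpow, hj v hvW]
    exact zpow_mem (pow_mem (mem_zpowers v) j) t
  · rw [le_normalizer_iff]
    rintro u hu _ ⟨t, rfl⟩
    have h1 := ((hvZ.2.1 u hu).zpow_left t).eq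
    change u * v ^ t * u⁻¹ ∈ _
    rw [← h1, mul_inv_cancel_right]
    exact zpow_mem (mem_zpowers v) t

/-- The submodularity of `Q` in `G = Q P` under an action of `Q` on `P` through an abelian group of
exponent dividing a divisor `q` of `p - 1`: by induction this holds modulo a normal subgroup `⟨v⟩`
of order `p`, and `Q` is modular in `Q ⟨v⟩`. -/
lemma SubmodularIn.of_sup_eq_top {G : Type u} [Group G] [Finite G] [Fact q.Prime]
    {P Q : Subgroup G} [P.Normal] (hP : IsPGroup p P) (htop : Q ⊔ P = ⊤) (hq : q ∣ p - 1)
    (hpow : ∀ x ∈ Q, ∀ u ∈ P, Commute (x ^ q) u)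
    (hcomm : ∀ x ∈ Q, ∀ y ∈ Q, ∀ u ∈ P, Commute ⁅x, y⁆ u) : SubmodularIn Q ⊤ := by
  obtain ⟨n, hn⟩ : ∃ n, n = Nat.card P := ⟨_, rfl⟩
  induction n using Nat.strong_induction_on generalizing G with
  | _ n ih =>
  by_cases hPbot : P = ⊥
  · rw [hPbot, sup_bot_eq] at htop
    rw [htop]
    exact .refl _
  obtain ⟨v, hvP, hv, hvn⟩ := exists_zpowers_normal hP hPbot htop hq hpow hcomm
  obtain ⟨f, hf⟩ : ∃ f, f = QuotientGroup.mk' (zpowers v) := ⟨_, rfl⟩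
  have hker : f.ker = zpowers v := hf ▸ QuotientGroup.ker_mk' _
  have hsurj : Function.Surjective f := hf ▸ QuotientGroup.mk'_surjective _
  have hPn : (P.map f).Normal := Normal.map inferInstance f hsurj
  have hcard : Nat.card (P.map f) < n := by
    have h1 : Nat.card (P.map f) ∣ Nat.card P := card_map_dvd P f
    refine lt_of_le_of_ne (hn ▸ Nat.le_of_dvd Nat.card_pos h1) fun e => ?_
    rw [hn] at e
    have hinj : Function.Injective (f.subgroupMap P) :=
      ((Nat.bijective_iff_surjective_and_card _).2 ⟨f.subgroupMap_surjective P, e.symm⟩).1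
    have h2 : (⟨v, hvP⟩ : P) = 1 := by
      refine hinj (Subtype.ext ?_)
      have h3 : v ∈ f.ker := hker.ge (mem_zpowers v)
      rw [map_one]
      exact h3
    have h4 : v = 1 := congrArg Subtype.val h2
    rw [h4, orderOf_one] at hv
    exact (Fact.out : p.Prime).one_lt.ne hv
  have h1 : SubmodularIn (Q.map f) ⊤ := by
    refine ih _ hcard (P := P.map f) (hP.map f) ?_ ?_ ?_ rfl
    · rw [← Subgroup.map_sup, htop, map_top_of_surjective f hsurj]
    · rintro _ ⟨x, hx, rfl⟩ _ ⟨u, hu, rfl⟩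
      rw [← map_pow]
      exact (hpow x hx u hu).map f
    · rintro _ ⟨x, hx, rfl⟩ _ ⟨y, hy, rfl⟩ _ ⟨u, hu, rfl⟩
      rw [← map_commutatorElement]
      exact (hcomm x hx y hy u hu).map f
  have h2 := h1.comap f
  rw [comap_top, comap_map_eq, hker] at h2
  refine SubmodularIn.trans ?_ h2
  obtain ⟨K, hK⟩ : ∃ K, K = Q ⊔ zpowers v := ⟨_, rfl⟩
  have hQK : Q ≤ K := hK ▸ le_sup_left
  have hvK : v ∈ K := hK ▸ le_sup_right (a := Q) (mem_zpowers v)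
  have hz : (zpowers v).subgroupOf K = zpowers (⟨v, hvK⟩ : K) := by
    have h3 : (zpowers (⟨v, hvK⟩ : K)).map K.subtype = zpowers v := by
      rw [MonoidHom.map_zpowers]; rfl
    rw [← h3, subgroupOf, comap_map_eq_self_of_injective K.subtype_injective]
  rw [← hK]
  refine ModularIn.submodularIn (modularIn_iff.2 ⟨hQK, modularIn_top_iff.1 ?_⟩)
  refine ModularIn.of_sup_zpowers (p := p) (q := q) (v := ⟨v, hvK⟩) ?_ ?_ ?_ ?_
  · rw [← hv, ← orderOf_coe]
  · rw [← hz]; exact hvn.subgroupOf K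
  · refine map_injective K.subtype_injective ?_
    rw [Subgroup.map_sup, subgroupOf_map_subtype, inf_eq_left.2 hQK, ← hz,
      subgroupOf_map_subtype, inf_eq_left.2 (zpowers_le.2 hvK), ← hK, ← MonoidHom.range_eq_map,
      range_subtype]
  · intro x hx
    exact Subtype.ext (hpow x (mem_subgroupOf.1 hx) v hvP).eq

/-- If a subgroup `Q` acts tamely on a normal `p`-subgroup `P`, and through an abelian group, then
`Q` is submodular in `Q P`. -/
theorem SubmodularIn.of_actsTamely {G : Type u} [Group G] [Finite G] [Fact q.Prime]
    {P Q : Subgroup G} [P.Normal] (hP : IsPGroup p P) (htame : ∀ x ∈ Q, ActsTamely q p P x)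
    (hcomm : ∀ x ∈ Q, ∀ y ∈ Q, ∀ u ∈ P, Commute ⁅x, y⁆ u) : SubmodularIn Q (Q ⊔ P) := by
  by_cases hq : q ∣ p - 1
  · obtain ⟨K, hK⟩ : ∃ K, K = Q ⊔ P := ⟨_, rfl⟩
    have hQK : Q ≤ K := hK ▸ le_sup_left
    have hPK : P ≤ K := hK ▸ le_sup_right
    rw [← hK, ← isSubmodular_subgroupOf_iff hQK, ← submodularIn_top_iff]
    refine SubmodularIn.of_sup_eq_top (p := p) (q := q) (P := P.subgroupOf K)
      hP.comap_subtype ?_ hq ?_ ?_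
    · refine map_injective K.subtype_injective ?_
      rw [Subgroup.map_sup, subgroupOf_map_subtype, inf_eq_left.2 hQK,
        subgroupOf_map_subtype, inf_eq_left.2 hPK, ← hK, ← MonoidHom.range_eq_map, range_subtype]
    · intro x hx u hu
      exact Subtype.ext ((htame x (mem_subgroupOf.1 hx)).1 u (mem_subgroupOf.1 hu)).eq
    · intro x hx y hy u hu
      exact Subtype.ext
        (hcomm x (mem_subgroupOf.1 hx) y (mem_subgroupOf.1 hy) u (mem_subgroupOf.1 hu)).eq
  · -- `Q` centralizes `P`
    refine (ModularIn.of_le_normalizer le_sup_left (sup_le le_normalizer ?_)).submodularIn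
    rw [le_normalizer_iff]
    intro u hu x hx
    rw [← (((htame x hx).2.resolve_left hq) u hu).eq, mul_inv_cancel_right]
    exact hx

end Subgroup

/-! ### Cyclic primary subgroups -/

namespace Subgroup

open scoped commutatorElement

universe u

/-- All cyclic subgroups of prime power order of `A` are submodular in `A`. They are given by their
generators, so that the notion lives inside the ambient group `G` of `A`. -/
def CyclicPrimarySubmodular {G : Type*} [Group G] (A : Subgroup G) : Prop :=
  ∀ (r k : ℕ), r.Prime → ∀ x ∈ A, x ^ r ^ k = 1 → SubmodularIn (zpowers x) A

lemma isPGroup_zpowers {G : Type*} [Group G] {r k : ℕ} {x : G} (h : x ^ r ^ k = 1) :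
    IsPGroup r (zpowers x) := by
  rintro ⟨_, j, rfl⟩
  refine ⟨k, Subtype.ext ?_⟩
  change (x ^ j) ^ r ^ k = 1
  rw [← zpow_natCast, zpow_comm, zpow_natCast, h, one_zpow]

lemma exists_pow_eq_one_of_mem_isPGroup {G : Type*} [Group G] {r : ℕ} {S : Subgroup G}
    (hS : IsPGroup r S) {x : G} (hx : x ∈ S) : ∃ k, x ^ r ^ k = 1 := by
  obtain ⟨k, hk⟩ := hS ⟨x, hx⟩
  exact ⟨k, congrArg Subtype.val hk⟩

lemma cyclicPrimarySubmodular_of_inClassC {G : Type*} [Group G] {A : Subgroup G}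
    (h : InClassC A) : CyclicPrimarySubmodular A := by
  intro r k hr x hx hxk
  have hle : zpowers x ≤ A := zpowers_le.2 hx
  rw [← isSubmodular_subgroupOf_iff hle]
  refine h r hr _ ?_ (isPGroup_zpowers hxk).comap_subtype
  exact isCyclic_of_surjective (subgroupOfEquivOfLe hle).symm
    (subgroupOfEquivOfLe hle).symm.surjective

lemma inClassC_of_cyclicPrimarySubmodular {G : Type*} [Group G] [Finite G]
    (h : CyclicPrimarySubmodular (⊤ : Subgroup G)) : InClassC G := by
  intro r hr X hX hXr
  rw [← submodularIn_top_iff]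
  obtain ⟨⟨x, hxX⟩, hx⟩ := hX.exists_generator
  obtain rfl : X = zpowers x := by
    refine le_antisymm (fun y hy => ?_) (zpowers_le.2 hxX)
    obtain ⟨j, hj⟩ := hx ⟨y, hy⟩
    exact ⟨j, congrArg Subtype.val hj⟩
  obtain ⟨k, hk⟩ := exists_pow_eq_one_of_mem_isPGroup hXr (mem_zpowers x)
  exact h r k hr x (mem_top x) hk

/-- An element `f a` of order a power of `r` is also the image of a power of `a` that has order a
power of `r`. -/
lemma exists_primePow_lift {G G' : Type*} [Group G] [Finite G] [Group G'] (f : G →* G')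
    {r k : ℕ} (hr : r.Prime) {a : G} (ha : f a ^ r ^ k = 1) :
    ∃ n m : ℕ, f (a ^ n) = f a ∧ (a ^ n) ^ r ^ m = 1 := by
  obtain ⟨m, s, hs, hms⟩ := Nat.exists_eq_pow_mul_and_not_dvd (orderOf_pos a).ne' r hr.ne_one
  have hcop : s.Coprime (orderOf (f a)) :=
    (Nat.Coprime.pow_right k ((Nat.Prime.coprime_iff_not_dvd hr).2 hs).symm).coprime_dvd_right
      (orderOf_dvd_of_pow_eq_one ha)
  obtain ⟨t, ht⟩ := exists_pow_eq_self_of_coprime hcop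
  refine ⟨s * t, m, ?_, ?_⟩
  · rw [map_pow, pow_mul, ht]
  · rw [← pow_mul, mul_right_comm, mul_comm s, ← hms, pow_mul, pow_orderOf_eq_one, one_pow]

lemma CyclicPrimarySubmodular.map {G G' : Type*} [Group G] [Finite G] [Group G']
    {A : Subgroup G} (h : CyclicPrimarySubmodular A) (f : G →* G') :
    CyclicPrimarySubmodular (A.map f) := by
  rintro r k hr _ ⟨a, ha, rfl⟩ hk
  obtain ⟨n, m, h1, h2⟩ := exists_primePow_lift f hr hk
  have h3 := (h r m hr (a ^ n) (pow_mem ha n) h2).map f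
  rwa [MonoidHom.map_zpowers, h1] at h3

/-- Subgroups of finite `p`-groups are submodular. -/
lemma SubmodularIn.of_isPGroup {G : Type*} [Group G] [Finite G] {p : ℕ} [Fact p.Prime]
    {P : Subgroup G} (hP : IsPGroup p P) {X : Subgroup G} (hX : X ≤ P) : SubmodularIn X P := by
  induction X using WellFoundedGT.induction with
  | _ X ih =>
  by_cases hPX : P ≤ X
  · rw [le_antisymm hX hPX]
    exact .refl _
  obtain ⟨u, huP, huX, hun⟩ := exists_mem_normalizer_notMem hP hX hPX
  have h1 : X ≤ normalizer (X : Set G) ⊓ P := le_inf le_normalizer hX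
  refine SubmodularIn.trans ?_ (ih _ (lt_of_le_of_ne h1 fun e => huX ?_) inf_le_right)
  · exact (ModularIn.of_le_normalizer h1 inf_le_left).submodularIn
  · rw [e]; exact ⟨hun, huP⟩

/-! ### Nilpotent normal subgroups -/

lemma mem_of_pow_eq_one_of_not_dvd_index {G : Type*} [Group G] [Finite G] {p k : ℕ}
    [Fact p.Prime] {P : Subgroup G} [P.Normal] (hP : ¬ p ∣ P.index) {x : G}
    (hx : x ^ p ^ k = 1) : x ∈ P := by
  rw [← QuotientGroup.eq_one_iff, ← orderOf_eq_one_iff]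
  refine Nat.eq_one_of_dvd_coprimes (a := p ^ k) (b := P.index) ?_ ?_ ?_
  · exact Nat.Coprime.pow_left k ((Nat.Prime.coprime_iff_not_dvd Fact.out).2 hP)
  · refine orderOf_dvd_of_pow_eq_one ?_
    rw [← QuotientGroup.mk_pow, hx, QuotientGroup.mk_one]
  · rw [index_eq_card]
    exact _root_.orderOf_dvd_natCard (x : G ⧸ P)

/-- In a nilpotent group elements of coprime prime power orders commute. -/
lemma commute_of_isNilpotent {G : Type*} [Group G] [Finite G] [Group.IsNilpotent G] {p r : ℕ}
    [Fact p.Prime] [Fact r.Prime] (hpr : p ≠ r) {x y : G} {k l : ℕ} (hx : x ^ p ^ k = 1)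
    (hy : y ^ r ^ l = 1) : Commute x y := by
  obtain ⟨S, hS⟩ := (isPGroup_zpowers hx).exists_le_sylow
  obtain ⟨T, hT⟩ := (isPGroup_zpowers hy).exists_le_sylow
  exact commute_of_normal_of_disjoint _ _ inferInstance inferInstance
    (IsPGroup.disjoint_of_ne p r hpr _ _ S.isPGroup' T.isPGroup') x y (hS (mem_zpowers x))
    (hT (mem_zpowers y))

/-- The `p'`-elements of prime power order of a nilpotent normal subgroup centralize the normal
`p`-subgroups. -/
lemma commute_of_mem_normal_isNilpotent {G : Type*} [Group G] [Finite G] {p r k : ℕ}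
    [Fact p.Prime] [Fact r.Prime] (hpr : p ≠ r) {J P : Subgroup G} [J.Normal]
    [Group.IsNilpotent J] [P.Normal] (hP : IsPGroup p P) {z : G} (hz : z ∈ J)
    (hzk : z ^ r ^ k = 1) : ∀ u ∈ P, Commute z u := by
  refine commute_of_commute_of_mem hpr (R := J ⊓ P) (hP.to_le inf_le_right) hzk ?_ ?_
  · rintro w ⟨hwJ, hwP⟩
    obtain ⟨l, hl⟩ := exists_pow_eq_one_of_mem_isPGroup hP hwP
    have h1 : Commute (⟨z, hz⟩ : J) ⟨w, hwJ⟩ :=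
      commute_of_isNilpotent hpr.symm (Subtype.ext hzk) (Subtype.ext hl)
    exact congrArg Subtype.val h1.eq
  · intro u hu
    refine ⟨?_, P.mul_mem (P.inv_mem hu) (Normal.conj_mem inferInstance u hu z)⟩
    have h1 := Normal.conj_mem (inferInstance : J.Normal) z hz u⁻¹
    simpa [mul_assoc] using J.mul_mem h1 (J.inv_mem hz)

/-- If `P` is a normal Sylow `p`-subgroup, then `F(G) ≤ P C_G(P)`. -/
lemma fittingSubgroup_le {G : Type*} [Group G] [Finite G] {p : ℕ} [Fact p.Prime]
    {P : Subgroup G} [P.Normal] (hP : IsPGroup p P) (hind : ¬ p ∣ P.index) :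
    fittingSubgroup G ≤ P ⊔ centralizer (P : Set G) := by
  refine sSup_le ?_
  rintro N ⟨hN, hnil⟩
  rw [← subgroupOf_eq_top]
  refine eq_top_of_forall_primePow _ fun z r k hr hz => ?_
  have : Fact r.Prime := ⟨hr⟩
  have hz' : (z : G) ^ r ^ k = 1 := by
    rw [← hz, ← orderOf_coe, pow_orderOf_eq_one]
  rw [mem_subgroupOf]
  by_cases hrp : r = p
  · subst hrp
    exact le_sup_left (a := P) (mem_of_pow_eq_one_of_not_dvd_index hind hz')
  · refine le_sup_right (a := P) (mem_centralizer_iff.2 fun u hu => ?_)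
    exact (commute_of_mem_normal_isNilpotent (Ne.symm hrp) hP z.2 hz' u hu).symm.eq

lemma map_fittingSubgroup_le {G G' : Type*} [Group G] [Group G'] {f : G →* G'}
    (hf : Function.Surjective f) : (fittingSubgroup G).map f ≤ fittingSubgroup G' := by
  rw [fittingSubgroup, (gc_map_comap f).l_sSup]
  refine iSup₂_le ?_
  rintro N ⟨hN, hnil⟩
  exact le_sSup ⟨hN.map f hf,
    Group.nilpotent_of_surjective (f.subgroupMap N) (f.subgroupMap_surjective N)⟩

/-- Tameness in terms of the image in `G / C_G(P)`. -/
lemma actsTamely_iff {G : Type*} [Group G] {p q : ℕ} {P : Subgroup G} [P.Normal] {x : G} :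
    ActsTamely q p P x ↔ QuotientGroup.mk' (centralizer (P : Set G)) x ^ q = 1 ∧
      (q ∣ p - 1 ∨ QuotientGroup.mk' (centralizer (P : Set G)) x = 1) := by
  have h : ∀ z : G, QuotientGroup.mk' (centralizer (P : Set G)) z = 1 ↔
      ∀ u ∈ P, Commute z u := by
    intro z
    rw [QuotientGroup.mk'_apply, QuotientGroup.eq_one_iff, mem_centralizer_iff]
    exact forall₂_congr fun u _ => eq_comm
  rw [ActsTamely, ← map_pow, h, h]

lemma ActsTamely.conj {G : Type*} [Group G] {p q : ℕ} {P : Subgroup G} [P.Normal] {x : G}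
    (h : ActsTamely q p P x) (g : G) :
    ActsTamely q p P (g * x * g⁻¹) := by
  rw [actsTamely_iff] at h ⊢
  refine ⟨?_, h.2.imp_right fun h2 => ?_⟩
  · rw [map_mul, map_mul, map_inv, conj_pow, h.1, mul_one, mul_inv_cancel]
  · rw [map_mul, map_mul, map_inv, h2, mul_one, mul_inv_cancel]

/-! ### Products of submodular subgroups -/

section Product

variable {G : Type u} [Group G] [Finite G] {p q : ℕ} [Fact p.Prime]

/-- In a product of submodular subgroups with submodular cyclic primary subgroups, `O_p(G)` is a
Sylow `p`-subgroup for the largest prime divisor `p` of `|G|`: it contains all `p`-elements of `A`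
and of `B`, so that `p` divides neither `|A O_p(G) / O_p(G)|` nor `|B O_p(G) / O_p(G)|`. -/
lemma not_dvd_index_pCore {A B : Subgroup G} (hAB : (A : Set G) * (B : Set G) = Set.univ)
    (hA : SubmodularIn A ⊤) (hB : SubmodularIn B ⊤) (hAC : CyclicPrimarySubmodular A)
    (hBC : CyclicPrimarySubmodular B) (hp : ∀ r : ℕ, r.Prime → r ∣ Nat.card G → r ≤ p) :
    ¬ p ∣ (pCore p (⊤ : Subgroup G)).index := by
  obtain ⟨O, hO⟩ : ∃ O, O = pCore p (⊤ : Subgroup G) := ⟨_, rfl⟩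
  have hOn : O.Normal := hO ▸ normal_pCore_top
  rw [← hO]
  have key : ∀ H : Subgroup G, SubmodularIn H ⊤ → CyclicPrimarySubmodular H →
      ¬ p ∣ O.relIndex H := by
    intro H hH hHC hdvd
    let S : Sylow p H := default
    have hS : (S : Subgroup H) ≤ O.subgroupOf H := by
      intro s hs
      rw [mem_subgroupOf]
      obtain ⟨k, hk⟩ := exists_pow_eq_one_of_mem_isPGroup S.isPGroup' hs
      have hk' : (s : G) ^ p ^ k = 1 := congrArg Subtype.val hk
      have h1 := ((hHC p k Fact.out s s.2 hk').trans hH).le_pCore_top hp (isPGroup_zpowers hk')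
      exact hO ▸ h1 (mem_zpowers _)
    exact S.not_dvd_index (hdvd.trans (index_dvd_of_le hS))
  intro hdvd
  obtain ⟨f, hf⟩ : ∃ f, f = QuotientGroup.mk' O := ⟨_, rfl⟩
  have hker : f.ker = O := hf ▸ QuotientGroup.ker_mk' _
  have hsurj : Function.Surjective f := hf ▸ QuotientGroup.mk'_surjective _
  have h1 : (A.map f : Set (G ⧸ O)) * (B.map f : Set (G ⧸ O)) = Set.univ := by
    rw [coe_map, coe_map, ← Set.image_mul, hAB, Set.image_univ, hsurj.range_eq]
  have h2 := card_mul_mul_card_inf (A.map f) (B.map f)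
  rw [h1, Nat.card_univ, ← index_eq_card, ← relIndex_ker, ← relIndex_ker, hker] at h2
  rcases (Nat.Prime.dvd_mul Fact.out).1 (hdvd.trans (Dvd.intro _ h2)) with h3 | h3
  · exact key A hA hAC h3
  · exact key B hB hBC h3

/-- If a submodular subgroup `A` with submodular cyclic primary subgroups covers a Sylow
`q`-subgroup modulo `P C_G(P)`, where `P` is a normal `p`-subgroup, then all `q`-elements of the
group act tamely on `P`, because modulo `C_G(P)` they are conjugate to `q`-elements of `A`. -/
lemma actsTamely_of_not_dvd_index [Fact q.Prime] (hpq : p ≠ q) {A P : Subgroup G} [P.Normal]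
    (hA : SubmodularIn A ⊤) (hAC : CyclicPrimarySubmodular A) (hP : IsPGroup p P)
    (hind : ¬ q ∣ (A ⊔ (P ⊔ centralizer (P : Set G))).index) {y : G} {k : ℕ}
    (hy : y ^ q ^ k = 1) : ActsTamely q p P y := by
  obtain ⟨C, hC⟩ : ∃ C, C = centralizer (P : Set G) := ⟨_, rfl⟩
  have hCn : C.Normal := hC ▸ inferInstance
  obtain ⟨f, hf⟩ : ∃ f, f = QuotientGroup.mk' C := ⟨_, rfl⟩
  have hker : f.ker = C := hf ▸ QuotientGroup.ker_mk' _
  have hsurj : Function.Surjective f := hf ▸ QuotientGroup.mk'_surjective _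
  have htame : ∀ x, ActsTamely q p P x ↔ f x ^ q = 1 ∧ (q ∣ p - 1 ∨ f x = 1) := by
    subst hC; subst hf; exact fun x => actsTamely_iff
  -- the image of a Sylow `q`-subgroup of `A` is a Sylow `q`-subgroup of the quotient
  let S : Sylow q A := default
  let S' : Sylow q (A.map f) := S.mapSurjective (f.subgroupMap_surjective A)
  obtain ⟨T, hT⟩ : ∃ T, T = (S' : Subgroup (A.map f)).map (A.map f).subtype := ⟨_, rfl⟩
  have hTq : IsPGroup q T := hT ▸ S'.isPGroup'.map _
  have hTtame : ∀ t ∈ T, t ^ q = 1 ∧ (q ∣ p - 1 ∨ t = 1) := by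
    rw [hT]
    rintro _ ⟨_, ⟨a, ha, rfl⟩, rfl⟩
    obtain ⟨l, hl⟩ := exists_pow_eq_one_of_mem_isPGroup S.isPGroup' ha
    have hl' : (a : G) ^ q ^ l = 1 := congrArg Subtype.val hl
    have h1 : ActsTamely q p P (a : G) :=
      ((hAC q l Fact.out a a.2 hl').trans hA).actsTamely hpq hP hl'
    exact (htame _).1 h1
  obtain ⟨R, hTR⟩ := hTq.exists_le_sylow
  have hPn : (P.map f).Normal := Normal.map inferInstance f hsurj
  have hcard : Nat.card R ∣ Nat.card T := by
    have h1 : Nat.card (A.map f) = Nat.card T * (S' : Subgroup (A.map f)).index := by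
      rw [hT, Nat.card_congr
        ((S' : Subgroup (A.map f)).equivMapOfInjective _ (subtype_injective _)).symm.toEquiv,
        card_mul_index]
    have h2 := card_mul_mul_card_inf (A.map f) (P.map f)
    rw [← mul_normal] at h2
    have h3 : (A.map f ⊔ P.map f).index = (A ⊔ (P ⊔ C)).index := by
      have h4 : (A ⊔ (P ⊔ C)).map f = A.map f ⊔ P.map f := by
        rw [Subgroup.map_sup, Subgroup.map_sup, (map_eq_bot_iff C).2 hker.ge, sup_bot_eq]
      rw [← h4, index_map_eq _ hsurj (hker.le.trans (le_sup_right.trans le_sup_right))]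
    have h4 : Nat.card R ∣ Nat.card T *
        ((S' : Subgroup (A.map f)).index * Nat.card (P.map f) * (A ⊔ (P ⊔ C)).index) := by
      have h5 : Nat.card R ∣ Nat.card (A.map f ⊔ P.map f : Subgroup (G ⧸ C)) *
          (A ⊔ (P ⊔ C)).index := by
        rw [← h3, card_mul_index]; exact card_subgroup_dvd_card _
      refine h5.trans ?_
      rw [← mul_assoc, ← mul_assoc, ← h1]
      exact mul_dvd_mul_right (Dvd.intro _ h2) _
    obtain ⟨n, hn⟩ := IsPGroup.iff_card.1 R.isPGroup'
    refine Nat.Coprime.dvd_of_dvd_mul_right ?_ h4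
    rw [hn]
    refine Nat.Coprime.pow_left n (Nat.Coprime.mul_right (Nat.Coprime.mul_right ?_ ?_) ?_)
    · exact (Nat.Prime.coprime_iff_not_dvd Fact.out).2 S'.not_dvd_index
    · obtain ⟨m, hm⟩ := IsPGroup.iff_card.1 (hP.map f)
      rw [hm]
      exact Nat.Coprime.pow_right m ((Nat.coprime_primes Fact.out Fact.out).2 hpq.symm)
    · exact (Nat.Prime.coprime_iff_not_dvd Fact.out).2 (hC ▸ hind)
  have hRT : (R : Subgroup (G ⧸ C)) = T :=
    (eq_of_le_of_card_ge hTR (Nat.le_of_dvd Nat.card_pos hcard)).symm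
  -- so every `q`-element of the quotient is conjugate to an element of `T`
  have hfy : IsPGroup q (zpowers (f y)) :=
    isPGroup_zpowers (k := k) (by rw [← map_pow, hy, map_one])
  obtain ⟨R', hR'⟩ := hfy.exists_le_sylow
  obtain ⟨g, hg⟩ := MulAction.exists_smul_eq (G ⧸ C) R R'
  have h1 : f y ∈ MulAut.conj g • (R : Subgroup (G ⧸ C)) := by
    have := hR' (mem_zpowers (f y))
    rwa [← hg] at this
  rw [mem_conj_smul, hRT] at h1
  obtain ⟨h2, h3⟩ := hTtame _ h1
  have e : f y = g * (g⁻¹ * f y * g) * g⁻¹ := by group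
  rw [htame, e]
  refine ⟨by rw [conj_pow, h2, mul_one, mul_inv_cancel], h3.imp_right fun h4 => ?_⟩
  rw [h4, mul_one, mul_inv_cancel]

/-- In a product `G = A B` some Sylow `q`-subgroup is generated by its intersections with `A`
and `B`. Sylow subgroups of `A` and of `B` lie in Sylow subgroups of `G` which are conjugate by an
element of the form `a b`, hence some conjugates of them under `A` and `B` lie in a common Sylow
subgroup, and the orders multiply up to at least its order. -/
lemma exists_sylow_le_sup [Fact q.Prime] {A B : Subgroup G}
    (hAB : (A : Set G) * (B : Set G) = Set.univ) :
    ∃ S : Sylow q G, (S : Subgroup G) ≤ ((S : Subgroup G) ⊓ A) ⊔ ((S : Subgroup G) ⊓ B) := by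
  let SA : Sylow q A := default
  let SB : Sylow q B := default
  obtain ⟨S₁, h₁⟩ := (SA.isPGroup'.map A.subtype).exists_le_sylow
  obtain ⟨S₂, h₂⟩ := (SB.isPGroup'.map B.subtype).exists_le_sylow
  obtain ⟨g, hg⟩ := MulAction.exists_smul_eq G S₁ S₂
  obtain ⟨a, ha, b, hb, hab⟩ : g⁻¹ ∈ (A : Set G) * (B : Set G) := hAB ▸ Set.mem_univ _
  simp only at hab
  have hS : b • S₂ = a⁻¹ • S₁ := by
    have hg' : g = b⁻¹ * a⁻¹ := by rw [← inv_inv g, ← hab, mul_inv_rev]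
    rw [← hg, smul_smul, hg', mul_inv_cancel_left]
  refine ⟨a⁻¹ • S₁, ?_⟩
  obtain ⟨S, hSdef⟩ : ∃ S, S = a⁻¹ • S₁ := ⟨_, rfl⟩
  rw [← hSdef] at hS ⊢
  have hA : Nat.card SA ≤ Nat.card ((S : Subgroup G) ⊓ A : Subgroup G) := by
    have h3 : MulAut.conj a⁻¹ • (SA : Subgroup A).map A.subtype ≤ (S : Subgroup G) ⊓ A := by
      refine le_inf ?_ ?_
      · rw [hSdef]
        exact pointwise_smul_le_pointwise_smul_iff.2 h₁
      · exact (pointwise_smul_le_pointwise_smul_iff.2 (map_subtype_le _)).trans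
          (conj_smul_eq_self_of_mem (inv_mem ha)).le
    refine le_trans ?_ (Nat.le_of_dvd Nat.card_pos (card_dvd_of_le h3))
    rw [card_conj_smul, Nat.card_congr
      ((SA : Subgroup A).equivMapOfInjective _ (subtype_injective _)).symm.toEquiv]
  have hB : Nat.card SB ≤ Nat.card ((S : Subgroup G) ⊓ B : Subgroup G) := by
    have h3 : MulAut.conj b • (SB : Subgroup B).map B.subtype ≤ (S : Subgroup G) ⊓ B := by
      refine le_inf ?_ ?_
      · rw [← hS]
        exact pointwise_smul_le_pointwise_smul_iff.2 h₂
      · exact (pointwise_smul_le_pointwise_smul_iff.2 (map_subtype_le _)).trans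
          (conj_smul_eq_self_of_mem hb).le
    refine le_trans ?_ (Nat.le_of_dvd Nat.card_pos (card_dvd_of_le h3))
    rw [card_conj_smul, Nat.card_congr
      ((SB : Subgroup B).equivMapOfInjective _ (subtype_injective _)).symm.toEquiv]
  obtain ⟨D, hD⟩ : ∃ D, D = ((S : Subgroup G) ⊓ A) ⊓ ((S : Subgroup G) ⊓ B) := ⟨_, rfl⟩
  have hDS : D ≤ S := hD ▸ inf_le_left.trans inf_le_left
  have hDAB : D ≤ A ⊓ B := hD ▸ inf_le_inf inf_le_right inf_le_right
  have hcard : Nat.card S * Nat.card D ≤ Nat.card SA * Nat.card SB := by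
    refine Nat.le_of_dvd (Nat.mul_pos Nat.card_pos Nat.card_pos) ?_
    have h3 := card_mul_mul_card_inf A B
    rw [hAB, Nat.card_univ] at h3
    have h4 : Nat.card S * Nat.card D ∣
        (Nat.card SA * Nat.card SB) * ((SA : Subgroup A).index * (SB : Subgroup B).index) := by
      rw [mul_mul_mul_comm, card_mul_index, card_mul_index, ← h3]
      exact mul_dvd_mul (card_subgroup_dvd_card _) (card_dvd_of_le hDAB)
    obtain ⟨m, hm⟩ := IsPGroup.iff_card.1 S.isPGroup'
    obtain ⟨n, hn⟩ := IsPGroup.iff_card.1 (S.isPGroup'.to_le hDS)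
    refine Nat.Coprime.dvd_of_dvd_mul_right ?_ h4
    rw [hm, hn, ← pow_add]
    exact Nat.Coprime.pow_left _ (Nat.Coprime.mul_right
      ((Nat.Prime.coprime_iff_not_dvd Fact.out).2 SA.not_dvd_index)
      ((Nat.Prime.coprime_iff_not_dvd Fact.out).2 SB.not_dvd_index))
  obtain ⟨E, hE⟩ : ∃ E, E = ((S : Subgroup G) ⊓ A) ⊔ ((S : Subgroup G) ⊓ B) := ⟨_, rfl⟩
  have hES : E ≤ S := hE ▸ sup_le inf_le_left inf_le_left
  have h5 := card_mul_mul_card_inf ((S : Subgroup G) ⊓ A) ((S : Subgroup G) ⊓ B)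
  have h6 : Nat.card (((S : Subgroup G) ⊓ A : Subgroup G) * ((S : Subgroup G) ⊓ B : Subgroup G) :
      Set G) ≤ Nat.card E := by
    refine Nat.card_mono (Set.toFinite (E : Set G)) ?_
    rintro _ ⟨x, hx, y, hy, rfl⟩
    rw [hE]
    exact mul_mem_sup hx hy
  have h7 : Nat.card S ≤ Nat.card E := by
    refine le_trans ?_ h6
    refine Nat.le_of_mul_le_mul_right (?_ : _ * Nat.card D ≤ _ * Nat.card D) Nat.card_pos
    rw [← hD] at h5
    rw [h5]
    exact hcard.trans (Nat.mul_le_mul hA hB)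
  rw [← hE, eq_of_le_of_card_ge hES h7]

/-- In a product of submodular subgroups with submodular cyclic primary subgroups, if the Sylow
`q`-subgroups act on a normal `p`-subgroup through abelian groups, then they act tamely: in an
abelian group tameness passes from the elements of `A` and `B` to their products. -/
lemma actsTamely_of_commute [Fact q.Prime] (hpq : p ≠ q) {A B P : Subgroup G} [P.Normal]
    (hAB : (A : Set G) * (B : Set G) = Set.univ)
    (hA : SubmodularIn A ⊤) (hB : SubmodularIn B ⊤) (hAC : CyclicPrimarySubmodular A)
    (hBC : CyclicPrimarySubmodular B) (hP : IsPGroup p P)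
    (hcomm : ∀ S : Sylow q G, ∀ x ∈ S, ∀ y ∈ S, ∀ u ∈ P, Commute ⁅x, y⁆ u)
    (S : Sylow q G) : ∀ x ∈ S, ActsTamely q p P x := by
  obtain ⟨S₀, hS₀⟩ := exists_sylow_le_sup (q := q) hAB
  have hS₀tame : ∀ x ∈ S₀, ActsTamely q p P x := by
    obtain ⟨f, hf⟩ : ∃ f, f = QuotientGroup.mk' (centralizer (P : Set G)) := ⟨_, rfl⟩
    have htame : ∀ x, ActsTamely q p P x ↔ f x ^ q = 1 ∧ (q ∣ p - 1 ∨ f x = 1) := by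
      subst hf; exact fun x => actsTamely_iff
    have hfc : ∀ x ∈ S₀, ∀ y ∈ S₀, Commute (f x) (f y) := by
      intro x hx y hy
      rw [← commutatorElement_eq_one_iff_commute, ← map_commutatorElement, hf,
        QuotientGroup.mk'_apply, QuotientGroup.eq_one_iff, mem_centralizer_iff]
      exact fun u hu => (hcomm S₀ x hx y hy u hu).symm.eq
    let T : Subgroup G :=
      { carrier := {x | x ∈ S₀ ∧ ActsTamely q p P x}
        one_mem' := ⟨one_mem (S₀ : Subgroup G), (htame 1).2 (by simp)⟩
        mul_mem' := fun {a b} ha hb => ⟨mul_mem (S := Subgroup G) ha.1 hb.1, by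
          have ha' := (htame a).1 ha.2
          have hb' := (htame b).1 hb.2
          rw [htame, map_mul, (hfc a ha.1 b hb.1).mul_pow, ha'.1, hb'.1, one_mul]
          refine ⟨rfl, ?_⟩
          rcases ha'.2 with h1 | h1
          · exact .inl h1
          · exact hb'.2.imp_right fun h2 => by rw [h1, h2, one_mul]⟩
        inv_mem' := fun {a} ha => ⟨inv_mem (S := Subgroup G) ha.1, by
          have ha' := (htame a).1 ha.2
          rw [htame, map_inv, inv_pow, ha'.1, inv_one]
          exact ⟨rfl, ha'.2.imp_right fun h1 => by rw [h1, inv_one]⟩⟩ }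
    have key : ∀ H : Subgroup G, SubmodularIn H ⊤ → CyclicPrimarySubmodular H →
        (S₀ : Subgroup G) ⊓ H ≤ T := by
      rintro H hH hHC x ⟨hxS, hxH⟩
      obtain ⟨k, hk⟩ := exists_pow_eq_one_of_mem_isPGroup S₀.isPGroup' hxS
      exact ⟨hxS, ((hHC q k Fact.out x hxH hk).trans hH).actsTamely hpq hP hk⟩
    exact fun x hx => (hS₀.trans (sup_le (key A hA hAC) (key B hB hBC)) hx).2
  intro x hx
  obtain ⟨g, rfl⟩ := MulAction.exists_smul_eq G S₀ S
  have h1 := (hS₀tame _ (mem_conj_smul.1 hx)).conj g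
  simpa [mul_assoc] using h1

end Product

/-! ### Induction on the order of the group -/

lemma submodularIn_sup_of_map {G : Type*} [Group G] {X P : Subgroup G} [P.Normal]
    (h : SubmodularIn (X.map (QuotientGroup.mk' P)) ⊤) : SubmodularIn (X ⊔ P) ⊤ := by
  have := h.comap (QuotientGroup.mk' P)
  rwa [comap_top, comap_map_eq, QuotientGroup.ker_mk'] at this

/-- Induction principle: a property of products `G = A B` of submodular subgroups with submodular
cyclic primary subgroups follows if it holds for trivial groups and can be lifted from `G / P`,
where `P` is a normal Sylow subgroup; the proof takes the one for the largest prime. -/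
lemma induction_on_normal_sylow {motive : ∀ (G : Type u) [Group G], Subgroup G → Subgroup G → Prop}
    (one : ∀ (G : Type u) [Group G] [Subsingleton G] (A B : Subgroup G), motive G A B)
    (step : ∀ (G : Type u) [Group G] [Finite G] (A B : Subgroup G),
      (A : Set G) * (B : Set G) = Set.univ → SubmodularIn A ⊤ → SubmodularIn B ⊤ →
      CyclicPrimarySubmodular A → CyclicPrimarySubmodular B →
      ∀ (p : ℕ) [Fact p.Prime] (P : Subgroup G) [P.Normal], IsPGroup p P → ¬ p ∣ P.index →
      motive (G ⧸ P) (A.map (QuotientGroup.mk' P)) (B.map (QuotientGroup.mk' P)) →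
      motive G A B)
    (G : Type u) [Group G] [Finite G] (A B : Subgroup G)
    (hAB : (A : Set G) * (B : Set G) = Set.univ) (hA : SubmodularIn A ⊤)
    (hB : SubmodularIn B ⊤) (hAC : CyclicPrimarySubmodular A)
    (hBC : CyclicPrimarySubmodular B) : motive G A B := by
  obtain ⟨n, hn⟩ : ∃ n, n = Nat.card G := ⟨_, rfl⟩
  induction n using Nat.strong_induction_on generalizing G with
  | _ n ih =>
  by_cases h1 : Nat.card G = 1
  · have := (Nat.card_eq_one_iff_unique.1 h1).1
    exact one G A B
  obtain ⟨p, hpmem, hpmax⟩ := (Nat.card G).primeFactors.exists_max_image id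
    (Nat.nonempty_primeFactors.2 (Nat.lt_of_le_of_ne Nat.card_pos (Ne.symm h1)))
  have hpp : Fact p.Prime := ⟨Nat.prime_of_mem_primeFactors hpmem⟩
  have hpd : p ∣ Nat.card G := Nat.dvd_of_mem_primeFactors hpmem
  have hmax : ∀ r : ℕ, r.Prime → r ∣ Nat.card G → r ≤ p := fun r hr hrd =>
    hpmax r (Nat.mem_primeFactors.2 ⟨hr, hrd, Nat.card_pos.ne'⟩)
  have hind := not_dvd_index_pCore hAB hA hB hAC hBC hmax
  refine step G A B hAB hA hB hAC hBC p (pCore p ⊤) (isPGroup_pCore p ⊤) hind ?_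
  obtain ⟨P, hP⟩ : ∃ P, P = pCore p (⊤ : Subgroup G) := ⟨_, rfl⟩
  have hPn : P.Normal := hP ▸ normal_pCore_top
  rw [← hP] at hind
  have hsurj := QuotientGroup.mk'_surjective P
  have htop : (⊤ : Subgroup G).map (QuotientGroup.mk' P) = ⊤ := map_top_of_surjective _ hsurj
  have hlt : Nat.card (G ⧸ P) < n := by
    rw [hn, ← index_eq_card]
    refine lt_of_le_of_ne (Nat.le_of_dvd Nat.card_pos (index_dvd_card P)) fun e => hind ?_
    rw [e]; exact hpd
  subst hP
  refine ih _ hlt _ _ _ ?_ ?_ ?_ (hAC.map _) (hBC.map _) rfl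
  · rw [coe_map, coe_map, ← Set.image_mul, hAB, Set.image_univ, hsurj.range_eq]
  · exact htop ▸ hA.map _
  · exact htop ▸ hB.map _

/-- If the indices of `A F(G)` and `B F(G)` are coprime, then for every prime `r` one of `A`, `B`
covers a Sylow `r`-subgroup modulo `F(G) ≤ P C_G(P)`, so that all `r`-elements act tamely on `P`. -/
theorem cyclicPrimarySubmodular_top_of_coprime {G : Type u} [Group G] [Finite G]
    {A B : Subgroup G} (hAB : (A : Set G) * (B : Set G) = Set.univ) (hA : SubmodularIn A ⊤)
    (hB : SubmodularIn B ⊤) (hAC : CyclicPrimarySubmodular A) (hBC : CyclicPrimarySubmodular B)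
    (hcop : Nat.Coprime (A ⊔ fittingSubgroup G).index (B ⊔ fittingSubgroup G).index) :
    CyclicPrimarySubmodular (⊤ : Subgroup G) := by
  revert hcop
  refine induction_on_normal_sylow (motive := fun G _ A B =>
    Nat.Coprime (A ⊔ fittingSubgroup G).index (B ⊔ fittingSubgroup G).index →
      CyclicPrimarySubmodular (⊤ : Subgroup G)) ?_ ?_ G A B hAB hA hB hAC hBC
  · intro G _ _ A B _ r k _ x _ _
    rw [Subsingleton.elim (zpowers x) ⊤]
    exact .refl _
  intro G _ _ A B hAB hA hB hAC hBC p _ P _ hP hind ih hcop r k hr x _ hx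
  have : Fact r.Prime := ⟨hr⟩
  have hsurj := QuotientGroup.mk'_surjective P
  by_cases hrp : r = p
  · subst hrp
    exact (SubmodularIn.of_isPGroup hP
      (zpowers_le.2 (mem_of_pow_eq_one_of_not_dvd_index hind hx))).trans
        (ModularIn.of_normal P).submodularIn
  have hdvd : ∀ H : Subgroup G, (H.map (QuotientGroup.mk' P) ⊔ fittingSubgroup (G ⧸ P)).index ∣
      (H ⊔ fittingSubgroup G).index := by
    intro H
    refine (index_dvd_of_le ?_).trans (index_map_dvd (H ⊔ fittingSubgroup G) hsurj)
    rw [Subgroup.map_sup]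
    exact sup_le_sup_left (map_fittingSubgroup_le hsurj) _
  have hquot := ih ((hcop.coprime_dvd_left (hdvd A)).coprime_dvd_right (hdvd B)) r k hr
    (QuotientGroup.mk' P x) (mem_top _) (by rw [← map_pow, hx, map_one])
  rw [← MonoidHom.map_zpowers] at hquot
  refine SubmodularIn.trans ?_ (submodularIn_sup_of_map hquot)
  have htame : ∀ y : G, y ∈ zpowers x → ActsTamely r p P y := by
    intro y hy
    obtain ⟨l, hl⟩ := exists_pow_eq_one_of_mem_isPGroup (isPGroup_zpowers hx) hy
    have hle : ∀ H : Subgroup G, ¬ r ∣ (H ⊔ fittingSubgroup G).index →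
        ¬ r ∣ (H ⊔ (P ⊔ centralizer (P : Set G))).index := fun H h h' =>
      h (h'.trans (index_dvd_of_le (sup_le_sup_left (fittingSubgroup_le hP hind) _)))
    by_cases hrA : r ∣ (A ⊔ fittingSubgroup G).index
    · have hrB : ¬ r ∣ (B ⊔ fittingSubgroup G).index := fun h =>
        Nat.not_coprime_of_dvd_of_dvd hr.one_lt hrA h hcop
      exact actsTamely_of_not_dvd_index (Ne.symm hrp) hB hBC hP (hle B hrB) hl
    · exact actsTamely_of_not_dvd_index (Ne.symm hrp) hA hAC hP (hle A hrA) hl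
  refine SubmodularIn.of_actsTamely hP htame ?_
  rintro _ ⟨i, rfl⟩ _ ⟨j, rfl⟩ u _
  have : ⁅x ^ i, x ^ j⁆ = 1 :=
    commutatorElement_eq_one_iff_commute.2 ((Commute.refl x).zpow_zpow i j)
  change Commute ⁅x ^ i, x ^ j⁆ u
  rw [this]
  exact Commute.one_left u

/-- If a nilpotent normal subgroup `J` contains the derived subgroups of all Sylow subgroups, then
the Sylow `r`-subgroups act on the normal Sylow `p`-subgroup `P` through abelian groups, because the
`r`-elements of `J` centralize `P`. The hypothesis is inherited by quotients. -/
theorem submodularIn_sylow_of_isNilpotent {G : Type u} [Group G] [Finite G]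
    {A B : Subgroup G} (hAB : (A : Set G) * (B : Set G) = Set.univ) (hA : SubmodularIn A ⊤)
    (hB : SubmodularIn B ⊤) (hAC : CyclicPrimarySubmodular A) (hBC : CyclicPrimarySubmodular B)
    (hJ : ∃ J : Subgroup G, J.Normal ∧ Group.IsNilpotent J ∧ ∀ (r : ℕ), r.Prime →
      ∀ S : Sylow r G, ∀ x ∈ S, ∀ y ∈ S, ⁅x, y⁆ ∈ J) :
    ∀ (r : ℕ), r.Prime → ∀ S : Sylow r G, SubmodularIn (S : Subgroup G) ⊤ := by
  revert hJ
  refine induction_on_normal_sylow (motive := fun G _ A B =>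
    (∃ J : Subgroup G, J.Normal ∧ Group.IsNilpotent J ∧ ∀ (r : ℕ), r.Prime →
      ∀ S : Sylow r G, ∀ x ∈ S, ∀ y ∈ S, ⁅x, y⁆ ∈ J) →
    ∀ (r : ℕ), r.Prime → ∀ S : Sylow r G, SubmodularIn (S : Subgroup G) ⊤)
    ?_ ?_ G A B hAB hA hB hAC hBC
  · intro G _ _ A B _ r _ S
    rw [Subsingleton.elim (S : Subgroup G) ⊤]
    exact .refl _
  rintro G _ _ A B hAB hA hB hAC hBC p _ P _ hP hind ih ⟨J, hJ, hnil, hcomm⟩ r hr S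
  have : Fact r.Prime := ⟨hr⟩
  have hsurj := QuotientGroup.mk'_surjective P
  by_cases hrp : r = p
  · subst hrp
    refine (SubmodularIn.of_isPGroup hP fun x hx => ?_).trans (ModularIn.of_normal P).submodularIn
    obtain ⟨k, hk⟩ := exists_pow_eq_one_of_mem_isPGroup S.isPGroup' hx
    exact mem_of_pow_eq_one_of_not_dvd_index hind hk
  have hquot := ih ⟨J.map (QuotientGroup.mk' P), hJ.map _ hsurj,
    Group.nilpotent_of_surjective ((QuotientGroup.mk' P).subgroupMap J)
      ((QuotientGroup.mk' P).subgroupMap_surjective J), by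
      intro l hl T
      have : Fact l.Prime := ⟨hl⟩
      obtain ⟨T', rfl⟩ := Sylow.mapSurjective_surjective hsurj l T
      rintro _ ⟨x, hx, rfl⟩ _ ⟨y, hy, rfl⟩
      rw [← map_commutatorElement]
      exact mem_map_of_mem _ (hcomm l hl T' x hx y hy)⟩ r hr (S.mapSurjective hsurj)
  rw [Sylow.coe_mapSurjective] at hquot
  refine SubmodularIn.trans ?_ (submodularIn_sup_of_map hquot)
  have hcent : ∀ T : Sylow r G, ∀ x ∈ T, ∀ y ∈ T, ∀ u ∈ P, Commute ⁅x, y⁆ u := by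
    intro T x hx y hy
    have h1 : ⁅x, y⁆ ∈ (T : Subgroup G) :=
      mul_mem (mul_mem (mul_mem hx hy) (inv_mem (S := Subgroup G) hx))
        (inv_mem (S := Subgroup G) hy)
    obtain ⟨k, hk⟩ := exists_pow_eq_one_of_mem_isPGroup T.isPGroup' h1
    exact commute_of_mem_normal_isNilpotent (Ne.symm hrp) hP (hcomm r hr T x hx y hy) hk
  exact SubmodularIn.of_actsTamely hP
    (actsTamely_of_commute (Ne.symm hrp) hAB hA hB hAC hBC hP hcent S) (hcent S)

/-! ### The residual for groups with abelian Sylow subgroups -/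

lemma normal_abelianSylowResidual (G : Type*) [Group G] : (abelianSylowResidual G).Normal := by
  refine ⟨fun n hn g => ?_⟩
  rw [abelianSylowResidual, mem_sInf] at hn ⊢
  rintro N ⟨hN, hNab⟩
  exact hN.conj_mem n (hn N ⟨hN, hNab⟩) g

/-- The residual contains the derived subgroups of the Sylow subgroups. -/
lemma commutatorElement_mem_abelianSylowResidual {G : Type*} [Group G] [Finite G] {r : ℕ}
    (hr : r.Prime) (S : Sylow r G) {x y : G} (hx : x ∈ S) (hy : y ∈ S) :
    ⁅x, y⁆ ∈ abelianSylowResidual G := by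
  have : Fact r.Prime := ⟨hr⟩
  rw [abelianSylowResidual, mem_sInf]
  rintro N ⟨hN, hNab⟩
  have hsurj := QuotientGroup.mk'_surjective N
  have h1 := hNab r hr (S.mapSurjective hsurj)
  have hx' : QuotientGroup.mk' N x ∈ S.mapSurjective hsurj := mem_map_of_mem _ hx
  have hy' : QuotientGroup.mk' N y ∈ S.mapSurjective hsurj := mem_map_of_mem _ hy
  have h2 : Commute (QuotientGroup.mk' N x) (QuotientGroup.mk' N y) :=
    congrArg Subtype.val (mul_comm' (⟨_, hx'⟩ : S.mapSurjective hsurj) ⟨_, hy'⟩)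
  rw [← QuotientGroup.eq_one_iff, ← QuotientGroup.mk'_apply, map_commutatorElement]
  exact commutatorElement_eq_one_iff_commute.2 h2

end Subgroup

theorem theorem2 {G : Type*} [Group G] [Finite G] (A B : Subgroup G)
    (hAB : (A : Set G) * (B : Set G) = Set.univ)
    (hA : IsSubmodular A) (hB : IsSubmodular B)
    (hAC : InClassC A) (hBC : InClassC B) :
    -- the set product `A F(G)` is the join, because `F(G)` is normal
    (Nat.Coprime (A ⊔ fittingSubgroup G).index (B ⊔ fittingSubgroup G).index → InClassC G) ∧
      (Group.IsNilpotent (abelianSylowResidual G) → InClassZ G) := by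
  have hA' := Subgroup.submodularIn_top_iff.2 hA
  have hB' := Subgroup.submodularIn_top_iff.2 hB
  have hAC' := Subgroup.cyclicPrimarySubmodular_of_inClassC hAC
  have hBC' := Subgroup.cyclicPrimarySubmodular_of_inClassC hBC
  refine ⟨fun hcop => ?_, fun hnil r hr S => ?_⟩
  · exact Subgroup.inClassC_of_cyclicPrimarySubmodular
      (Subgroup.cyclicPrimarySubmodular_top_of_coprime hAB hA' hB' hAC' hBC' hcop)
  · exact Subgroup.submodularIn_top_iff.1
      (Subgroup.submodularIn_sylow_of_isNilpotent hAB hA' hB' hAC' hBC'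
        ⟨_, Subgroup.normal_abelianSylowResidual G, hnil, fun l hl T x hx y hy =>
          Subgroup.commutatorElement_mem_abelianSylowResidual hl T hx hy⟩ r hr S)
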